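/- Let $\beta>0$, let $\mathbb{E}=\mathbb{C}^*/\Gamma_\beta$ be the elliptic curve obtained as the quotient of $\mathbb{C}^*=\mathbb{C}\setminus\{0\}$ by the multiplicative group $\Gamma_\beta=\{e^{2k\pi\beta}: k\in\mathbb{Z}\}$, with projection $w\mapsto[w]$, and let $X=\mathbb{P}^1\times\mathbb{E}$, where $z:\mathbb{P}^1\to\mathbb{C}\cup\{\infty\}$ is the inhomogeneous coordinate. Give $X$ the Hermitian metric $ds^2=\phi\otimes\overline{\phi}+\psi\otimes\overline{\psi}$ with $\phi=\frac{dz}{1+|z|^2}$ and $\psi=\frac{dw}{w}$, and define $L^2$ and the Sobolev space $W^1$ (functions in $L^2$ whose differential in the sense of distributions is an $L^2$ one-form) with respect to it. Let $$\mathbb{O}=\{(z,[w])\in X:\ \mathrm{Re}(zw)>0\},\qquad \mathbb{A}=\{W\in\mathbb{C}:\ e^{-\pi/(2\beta)}<|W|<e^{\pi/(2\beta)}\},$$ and let $\Phi:\mathbb{C}^*\times\mathbb{A}\to\mathbb{O}$, $\Phi(Z,W)=\left(Z,\left[Z^{-1}\exp(i\beta\log W)\right]\right)$, be the product model of $\mathbb{O}$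 (the class does not depend on the branch of the logarithm). Let $\mathcal{O}(\cdot)$ denote the space of holomorphic functions. (1) A function $f$ on $\mathbb{O}$ belongs to $\mathcal{O}(\mathbb{O})\cap L^2(\mathbb{O})$ if and only if there is a holomorphic function $g$ on $\mathbb{A}$, square integrable with respect to Lebesgue measure, such that $f(\Phi(Z,W))=g(W)$ for all $(Z,W)\in\mathbb{C}^*\times\mathbb{A}$. (2) A function $f$ on $\mathbb{O}$ belongs to $\mathcal{O}(\mathbb{O})\cap W^1(\mathbb{O})$ if and only if it is constant. (3) Statements (1) and (2) remain true if $\mathbb{O}$ is replaced by $X\setminus\overline{\mathbb{O}}$ and $\Phi$ by the product model $(Z,W)\mapsto\left(-Z,\left[Z^{-1}\exp(i\beta\log W)\right]\right)$ of $X\setminus\overline{\mathbb{O}}$, which is $\Phi$ followed by $(z,[w])\mapsto(-z,[w])$. -/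

import Mathlib

open MeasureTheory Set
open scoped ContDiff

noncomputable section

namespace Ohsawa

/-- The cyclic subgroup `Γ_β = {e^{2kπβ} | k ∈ ℤ}` of `ℂ^* = ℂ \ {0}`. -/
def Gam (β : ℝ) : Subgroup ℂˣ :=
  Subgroup.zpowers (Units.mk0 (Complex.exp (2 * Real.pi * β)) (Complex.exp_ne_zero _))

/-- The elliptic curve `𝔼 = ℂ^* / Γ_β`, with the quotient topology. -/
abbrev EllCurve (β : ℝ) : Type := ℂˣ ⧸ Gam β

/-- The compact complex surface `X = ℙ¹ × 𝔼`. The projective line is the one-point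
compactification of `ℂ`, and `z : ℙ¹ → ℂ ∪ {∞}` is the inhomogeneous coordinate. -/
abbrev Surface (β : ℝ) : Type := OnePoint ℂ × EllCurve β

/-- The projection `w ↦ [w]` from `ℂ^*` to `𝔼` (with an irrelevant value at `w = 0`). -/
def proj (β : ℝ) (w : ℂ) : EllCurve β :=
  if h : w = 0 then 1 else QuotientGroup.mk (Units.mk0 w h)

/-- The two standard affine parametrizations of `ℙ¹`: the chart `false` is `z ↦ z`, with image
`ℙ¹ \ {∞}`, and the chart `true` is `ζ ↦ 1/ζ` (with `0 ↦ ∞`), with image `ℙ¹ \ {0}`. -/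
def affine : Bool → ℂ → OnePoint ℂ
  | false, z => (z : OnePoint ℂ)
  | true, ζ => if ζ = 0 then OnePoint.infty else ((ζ⁻¹ : ℂ) : OnePoint ℂ)

/-- The two parametrizations `(z, w) ↦ (z, [w])` and `(ζ, w) ↦ (1/ζ, [w])` of `X`, to be used for
`w ≠ 0`. Each is a local homeomorphism on `ℂ × ℂ^*`; together they cover `X`, and their local
inverses are the holomorphic charts that define the complex structure of `X`. -/
def param (β : ℝ) (c : Bool) (x : ℂ × ℂ) : Surface β := (affine c x.1, proj β x.2)

/-- The part of `ℂ × ℂ^*` that the parametrization `c` sends to `U`. -/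
def coordDom (β : ℝ) (c : Bool) (U : Set (Surface β)) : Set (ℂ × ℂ) :=
  {x | x.2 ≠ 0 ∧ param β c x ∈ U}

/-- `f` is holomorphic on the open set `U` of `X`: it is holomorphic in the charts of `X`. -/
def HolomorphicOn {β : ℝ} (f : Surface β → ℂ) (U : Set (Surface β)) : Prop :=
  ∀ c : Bool, DifferentiableOn ℂ (fun x => f (param β c x)) (coordDom β c U)

/-- The part of `ℂ × ℂ^*` in which `w` lies in the fundamental domain `1 ≤ |w| < e^{2πβ}` of
`Γ_β`. Either parametrization of `X` is injective on it and its image has a complement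
of measure zero (one of the curves `{∞} × 𝔼` and `{0} × 𝔼`). -/
def fundDom (β : ℝ) : Set (ℂ × ℂ) :=
  {x | 1 ≤ ‖x.2‖ ∧ ‖x.2‖ < Real.exp (2 * Real.pi * β)}

/-- The Riemannian volume of the metric `ds² = φ ⊗ φ̄ + ψ ⊗ ψ̄` on `X`, where
`φ = dz / (1 + |z|²)` and `ψ = dw / w`, written in the coordinates `(z, w)` with `w` in the
fundamental domain. Since `ζ = 1/z` changes `φ` only by a factor of modulus one, the expression
is the same in the coordinates `(ζ, w)`. -/
def coordVol (β : ℝ) : Measure (ℂ × ℂ) :=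
  (volume.restrict (fundDom β)).withDensity
    (fun x => ENNReal.ofReal (1 / ((1 + ‖x.1‖ ^ 2) ^ 2 * ‖x.2‖ ^ 2)))

/-- `f ∈ L²(U)`, with respect to the Riemannian volume of `X`. (The curve `{∞} × 𝔼`, which the
coordinates `(z, w)` miss, has volume zero.) -/
def SquareIntegrableOn {β : ℝ} (f : Surface β → ℂ) (U : Set (Surface β)) : Prop :=
  MemLp (fun x => f (param β false x)) 2 ((coordVol β).restrict (coordDom β false U))

/-- `D` is the weak (distributional) differential of `u` on the open set `V ⊆ ℂ² = ℝ⁴`: both are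
locally integrable on `V`, and integration by parts holds against every smooth
function with compact support in `V`, in every real direction `v`. -/
def HasWeakDifferentialOn (u : ℂ × ℂ → ℂ) (D : ℂ × ℂ → (ℂ × ℂ →L[ℝ] ℂ)) (V : Set (ℂ × ℂ)) :
    Prop :=
  LocallyIntegrableOn u V volume ∧ LocallyIntegrableOn D V volume ∧
    ∀ η : ℂ × ℂ → ℝ, ContDiff ℝ ∞ η → HasCompactSupport η → tsupport η ⊆ V →
      ∀ v : ℂ × ℂ, ∫ x, (fderiv ℝ η x v) • u x = - ∫ x, η x • D x v

/-- The squared length, in the metric `ds² = φ ⊗ φ̄ + ψ ⊗ ψ̄`, of a complex-valued real covector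
`D` at the point with coordinates `x = (z, w)` (or `(ζ, w)`): the sum of `|D(e)|²` over the
orthonormal real frame `(1 + |z|²) ∂_z`, `(1 + |z|²) i ∂_z`, `w ∂_w`, `w i ∂_w`. -/
def covectorNormSq (x : ℂ × ℂ) (D : ℂ × ℂ →L[ℝ] ℂ) : ℝ :=
  ‖D (((1 + ‖x.1‖ ^ 2 : ℝ) : ℂ), 0)‖ ^ 2 + ‖D (((1 + ‖x.1‖ ^ 2 : ℝ) : ℂ) * Complex.I, 0)‖ ^ 2 +
    (‖D (0, x.2)‖ ^ 2 + ‖D (0, x.2 * Complex.I)‖ ^ 2)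

/-- `f ∈ W¹(U)`, the `L²` Sobolev space of order one on the open set `U` of `X`: `f ∈ L²(U)`, and
the differential `df` in the sense of distributions is an `L²` one-form on `U`. -/
def SobolevOneOn {β : ℝ} (f : Surface β → ℂ) (U : Set (Surface β)) : Prop :=
  SquareIntegrableOn f U ∧
    ∀ c : Bool, ∃ D : ℂ × ℂ → (ℂ × ℂ →L[ℝ] ℂ),
      HasWeakDifferentialOn (fun x => f (param β c x)) D (coordDom β c U) ∧
      ∫⁻ x in coordDom β c U, ENNReal.ofReal (covectorNormSq x (D x)) ∂(coordVol β) < ⊤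

/-- The domain `𝕆 = {(z, [w]) ∈ X : Re (z w) > 0}`; the condition does not depend on the
choice of `w` in its class, and it includes that `z ≠ 0` and `z ≠ ∞`. -/
def domainO (β : ℝ) : Set (Surface β) :=
  {p | ∃ z w : ℂ, w ≠ 0 ∧ 0 < (z * w).re ∧ p = ((z : OnePoint ℂ), proj β w)}

/-- The annulus `𝔸 = {W : e^{-π/(2β)} < |W| < e^{π/(2β)}}`. -/
def annulus (β : ℝ) : Set ℂ :=
  {W | Real.exp (-(Real.pi / (2 * β))) < ‖W‖ ∧ ‖W‖ < Real.exp (Real.pi / (2 * β))}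

/-- The product model `Φ : ℂ^* × 𝔸 → 𝕆`, `Φ(Z, W) = (Z, [Z⁻¹ exp(iβ log W)])`. The class
does not depend on the choice of the logarithm. -/
def modelO (β : ℝ) (Z W : ℂ) : Surface β :=
  ((Z : OnePoint ℂ), proj β (Z⁻¹ * Complex.exp (Complex.I * β * Complex.log W)))

/-- The product model of `X \ closure 𝕆`: the map `Φ` followed by the isometric biholomorphism
`(z, [w]) ↦ (-z, [w])` of `X`, which carries `𝕆` onto `X \ closure 𝕆`. -/
def modelExt (β : ℝ) (Z W : ℂ) : Surface β :=
  (((-Z : ℂ) : OnePoint ℂ), proj β (Z⁻¹ * Complex.exp (Complex.I * β * Complex.log W)))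

end Ohsawa

end

noncomputable section

namespace Ohsawa

open Filter Topology Metric

/-! Both domains are sectors `Re (ε z w) > 0`, with `ε = 1` for `𝕆` and `ε = -1` for the complement
of its closure, so one argument with a parameter `ε ≠ 0` serves all four statements.

In the coordinates `(z, u)` with `u = ε z w`, the sector is `ℂ^*` times the half-plane `Re u > 0`
modulo `Γ_β`. For fixed `z` the passage from `w` to `u` is a multiplication, which preserves `dλ(w)
/ |w|²`; the volume is therefore the product of the Fubini–Study area in `z` and the invariant area
in `u` (`lintegral_coordVol`). By Tonelli, a square integrable holomorphic `f` restricts for almost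
every `u` to a Fubini–Study square integrable holomorphic function of `z ∈ ℂ^*`. Its singularities
at `0` and `∞` are removable, so it is constant by Liouville (`eq_of_lintegral_fsMeasure_ne_top`).
The identity theorem extends this to every `u`, and `f = g(ε z w)` with `g` invariant under `Γ_β`
(`exists_factorsThrough`). The map `u ↦ exp (-i log u / β)` identifies the half-plane modulo `Γ_β`
with the annulus, and the two areas are comparable there; the Fubini–Study area is finite, so `L²`
means the same on both sides (`bergman_sector_iff`).

For `W¹`, the unit frame vector `(1 + |z|²) ∂_z` brings in a factor that cancels the Fubini–Study
density exactly. Fixing one good `w` and letting `z` vary shows that `g` has finite Dirichlet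
integral over the whole half-plane (`FactorsThrough.lintegral_deriv_lt_top`). That integral is
invariant under scaling, and the half-plane contains infinitely many `Γ_β`-translates of a
fundamental half-ring, all contributing equally; hence `g' = 0`
(`exists_const_of_lintegral_deriv_lt_top`). -/

/-! ### Holomorphic change of variables and mean value inequalities in the plane. -/

theorem memLp_two_iff_lintegral_enorm_sq {α E : Type*} [MeasurableSpace α] [NormedAddCommGroup E]
    {ν : Measure α} {f : α → E} (hf : AEStronglyMeasurable f ν) :
    MemLp f 2 ν ↔ ∫⁻ x, ‖f x‖ₑ ^ 2 ∂ν < ⊤ := by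
  rw [MemLp, and_iff_right hf,
    eLpNorm_lt_top_iff_lintegral_rpow_enorm_lt_top two_ne_zero ENNReal.ofNat_ne_top]
  simp

theorem det_complex_smul (a : ℂ) : (a • (1 : ℂ →L[ℝ] ℂ)).det = ‖a‖ ^ 2 := by
  rw [ContinuousLinearMap.det, ← Complex.normSq_eq_norm_sq, ← Algebra.norm_complex_apply,
    Algebra.norm_apply]
  congr 1

/-- Change of variables in the plane along an injective holomorphic map. -/
theorem lintegral_image_eq_lintegral_enorm_deriv_sq_mul {s : Set ℂ} (hs : MeasurableSet s)
    {f f' : ℂ → ℂ} (hf' : ∀ x ∈ s, HasDerivAt f (f' x) x) (hf : InjOn f s) (g : ℂ → ENNReal) :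
    ∫⁻ x in f '' s, g x = ∫⁻ x in s, ‖f' x‖ₑ ^ 2 * g (f x) := by
  rw [lintegral_image_eq_lintegral_abs_det_fderiv_mul volume hs
    (fun x hx => ((hf' x hx).complexToReal_fderiv).hasFDerivWithinAt) hf]
  refine lintegral_congr fun x => ?_
  rw [det_complex_smul, abs_of_nonneg (by positivity), ENNReal.ofReal_pow (norm_nonneg _),
    ofReal_norm]

theorem lintegral_comp_mul_left (g : ℂ → ENNReal) {c : ℂ} (hc : c ≠ 0) :
    ∫⁻ x, g x = ‖c‖ₑ ^ 2 * ∫⁻ x, g (c * x) := by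
  have h := lintegral_image_eq_lintegral_enorm_deriv_sq_mul (s := univ) (f := fun x => c * x)
    (f' := fun _ => c) MeasurableSet.univ
    (fun x _ => by simpa using (hasDerivAt_id x).const_mul c)
    (fun x _ y _ hxy => mul_left_cancel₀ hc hxy) g
  rw [image_univ_of_surjective (mul_left_surjective₀ hc)] at h
  simp only [Measure.restrict_univ] at h
  rw [h, lintegral_const_mul']
  simp

/-- The mean value inequality on circles. -/
theorem enorm_le_lintegral_circle {q : ℂ → ℂ} {c : ℂ} {R : ℝ} (hR : 0 < R)
    (hq : DifferentiableOn ℂ q (closedBall c R)) :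
    ENNReal.ofReal (2 * Real.pi) * ‖q c‖ₑ ≤
      ∫⁻ θ in Ioo (-Real.pi) Real.pi, ‖q (circleMap c R θ)‖ₑ := by
  have h : Real.circleAverage q c R = q c := by
    apply DiffContOnCl.circleAverage
    apply DifferentiableOn.diffContOnCl
    rwa [abs_of_pos hR, closure_ball _ hR.ne']
  rw [Real.circleAverage_eq_integral_add (-Real.pi), intervalIntegral.integral_comp_add_right
    (fun θ => q (circleMap c R θ)), intervalIntegral.integral_of_le (by linarith [Real.pi_pos])] at h
  have h2 : (∫ θ in Ioc (0 + -Real.pi) (2 * Real.pi + -Real.pi), q (circleMap c R θ)) =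
      (2 * Real.pi) • q c := by
    rw [← h, smul_smul, mul_inv_cancel₀ (by positivity), one_smul]
  have h3 : ‖(2 * Real.pi) • q c‖ₑ = ENNReal.ofReal (2 * Real.pi) * ‖q c‖ₑ := by
    rw [enorm_smul, Real.enorm_of_nonneg (by positivity)]
  rw [← h3, ← h2, restrict_Ioo_eq_restrict_Ioc]
  convert! enorm_integral_le_lintegral_enorm _ using 4 <;> ring

/-- The mean value inequality on discs, with a constant that is not optimal. -/
theorem enorm_le_lintegral_ball {q : ℂ → ℂ} {c : ℂ} {r : ℝ} (hr : 0 < r)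
    (hq : DifferentiableOn ℂ q (ball c r)) :
    ENNReal.ofReal (r ^ 2) * ‖q c‖ₑ ≤ ∫⁻ z in ball c r, ‖q z‖ₑ := by
  have hπ := Real.pi_gt_three
  -- Radii above `r / 2` suffice: there the Jacobian `ρ` is at least `r / 2`, and `(r / 2) * (r / 2)
  -- * 2π = π r² / 2 ≥ r²`.
  let S : Set (ℝ × ℝ) := Ioo (r / 2) r ×ˢ Ioo (-Real.pi) Real.pi
  have hmem : ∀ p ∈ S, circleMap c p.1 p.2 ∈ ball c r := by
    intro p hp
    have h1 := hp.1.1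
    have h2 := hp.1.2
    rw [mem_ball, dist_eq_norm, circleMap_sub_center, norm_circleMap_zero, abs_of_pos]
    · exact h2
    · linarith
  have hS : MeasurableSet S := measurableSet_Ioo.prod measurableSet_Ioo
  have hcont : ContinuousOn (fun p : ℝ × ℝ => ‖q (circleMap c p.1 p.2)‖ₑ) S := by
    have hcm : Continuous fun p : ℝ × ℝ => circleMap c p.1 p.2 := by
      unfold circleMap
      fun_prop
    exact (hq.continuousOn.comp hcm.continuousOn hmem).enorm
  calc ENNReal.ofReal (r ^ 2) * ‖q c‖ₑ
      ≤ ∫⁻ _ in Ioo (r / 2) r, ENNReal.ofReal (r / 2) * (ENNReal.ofReal (2 * Real.pi) * ‖q c‖ₑ) := by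
        rw [setLIntegral_const, Real.volume_Ioo, mul_comm _ (ENNReal.ofReal (r - r / 2)),
          ← mul_assoc, ← mul_assoc, ← ENNReal.ofReal_mul (by linarith),
          ← ENNReal.ofReal_mul (by nlinarith)]
        gcongr
        nlinarith [sq_pos_of_pos hr]
    _ ≤ ∫⁻ ρ in Ioo (r / 2) r, ∫⁻ θ in Ioo (-Real.pi) Real.pi,
          ENNReal.ofReal ρ * ‖q (circleMap c ρ θ)‖ₑ := by
        refine setLIntegral_mono' measurableSet_Ioo fun ρ hρ => ?_
        rw [lintegral_const_mul' _ _ ENNReal.ofReal_ne_top]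
        gcongr
        · exact hρ.1.le
        · exact enorm_le_lintegral_circle (by linarith [hρ.1])
            (hq.mono (closedBall_subset_ball hρ.2))
    _ = ∫⁻ p in S, ENNReal.ofReal p.1 * ‖q (circleMap c p.1 p.2)‖ₑ := by
        rw [Measure.volume_eq_prod, setLIntegral_prod]
        exact (by fun_prop : Measurable fun p : ℝ × ℝ => ENNReal.ofReal p.1).aemeasurable.mul
          (hcont.aemeasurable hS)
    _ = ∫⁻ p in S, ENNReal.ofReal p.1 •
          (ball c r).indicator (fun z => ‖q z‖ₑ) (c + Complex.polarCoord.symm p) := by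
        refine setLIntegral_congr_fun hS fun p hp => ?_
        have : c + Complex.polarCoord.symm p = circleMap c p.1 p.2 := by
          rw [Complex.polarCoord_symm_apply, circleMap, Complex.exp_mul_I]
          push_cast
          ring
        simp only [this, smul_eq_mul]
        rw [indicator_of_mem (hmem p hp)]
    _ ≤ ∫⁻ p in polarCoord.target, ENNReal.ofReal p.1 •
          (ball c r).indicator (fun z => ‖q z‖ₑ) (c + Complex.polarCoord.symm p) := by
        refine lintegral_mono_set ?_
        rw [polarCoord_target]
        refine prod_mono (fun x hx => ?_) subset_rfl
        exact lt_trans (by linarith) hx.1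
    _ = ∫⁻ z in ball c r, ‖q z‖ₑ := by
        rw [Complex.lintegral_comp_polarCoord_symm
          (fun z => (ball c r).indicator (fun z => ‖q z‖ₑ) (c + z)),
          lintegral_add_left_eq_self, lintegral_indicator measurableSet_ball]

/-! ### Square integrable holomorphic functions on `ℂ \ {0}` for the Fubini–Study area. -/

/-- The density of the Fubini–Study area. -/
def fsDensity (z : ℂ) : ENNReal := ENNReal.ofReal (1 / (1 + ‖z‖ ^ 2) ^ 2)

theorem measurable_fsDensity : Measurable fsDensity := by
  unfold fsDensity
  fun_prop

/-- The Fubini–Study area in the affine coordinate. -/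
def fsMeasure : Measure ℂ := volume.withDensity fsDensity

/-- Every point of the ball has modulus at least `‖z‖ / 2`. The bound is `π t / (1 + t)²` with `t =
‖z‖² / 4`, which is small both near `0` and near `∞`. -/
theorem fsMeasure_ball_le {z : ℂ} (hz : z ≠ 0) :
    fsMeasure (ball z (‖z‖ / 2)) ≤
      ENNReal.ofReal (Real.pi * (‖z‖ ^ 2 / 4 / (1 + ‖z‖ ^ 2 / 4) ^ 2)) := by
  have h0 : 0 < ‖z‖ := norm_pos_iff.2 hz
  rw [fsMeasure, withDensity_apply _ measurableSet_ball]
  calc ∫⁻ x in ball z (‖z‖ / 2), fsDensity x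
      ≤ ∫⁻ x in ball z (‖z‖ / 2), ENNReal.ofReal (1 / (1 + ‖z‖ ^ 2 / 4) ^ 2) := by
        refine setLIntegral_mono' measurableSet_ball fun x hx => ?_
        have h1 : ‖z‖ / 2 ≤ ‖x‖ := by
          have := norm_sub_norm_le z x
          rw [mem_ball', dist_eq_norm] at hx
          linarith
        have h2 : ‖z‖ ^ 2 / 4 ≤ ‖x‖ ^ 2 := by nlinarith
        unfold fsDensity
        gcongr
    _ = _ := by
        rw [setLIntegral_const, Complex.volume_ball, ← ENNReal.ofReal_pow (by positivity),
          ← ENNReal.ofReal_coe_nnreal, NNReal.coe_real_pi, ← ENNReal.ofReal_mul (by positivity),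
          ← ENNReal.ofReal_mul (by positivity)]
        congr 1
        ring

/-- The mean value inequality is applied to `p²`; points of the ball have modulus at most `2 ‖z‖`,
which bounds the density from below. -/
theorem le_lintegral_fsMeasure_ball {p : ℂ → ℂ} (hp : DifferentiableOn ℂ p {0}ᶜ) {z : ℂ}
    (hz : z ≠ 0) :
    ENNReal.ofReal ((‖p z‖ * ‖z‖ / (2 * (1 + 4 * ‖z‖ ^ 2))) ^ 2) ≤
      ∫⁻ x in ball z (‖z‖ / 2), ‖p x‖ₑ ^ 2 ∂fsMeasure := by
  have h0 : 0 < ‖z‖ := norm_pos_iff.2 hz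
  have hsub : ball z (‖z‖ / 2) ⊆ {0}ᶜ := by
    rintro x hx rfl
    rw [mem_ball', dist_zero_right] at hx
    linarith
  have hmv := enorm_le_lintegral_ball (half_pos h0) ((hp.mono hsub).pow 2)
  rw [fsMeasure, setLIntegral_withDensity_eq_setLIntegral_mul_non_measurable _
    measurable_fsDensity _ measurableSet_ball (by simp [fsDensity])]
  calc ENNReal.ofReal ((‖p z‖ * ‖z‖ / (2 * (1 + 4 * ‖z‖ ^ 2))) ^ 2)
      = ENNReal.ofReal (1 / (1 + 4 * ‖z‖ ^ 2) ^ 2) *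
          (ENNReal.ofReal ((‖z‖ / 2) ^ 2) * ‖(p ^ 2) z‖ₑ) := by
        rw [Pi.pow_apply, ← ofReal_norm, norm_pow, ← ENNReal.ofReal_mul (by positivity),
          ← ENNReal.ofReal_mul (by positivity)]
        congr 1
        field_simp
    _ ≤ ENNReal.ofReal (1 / (1 + 4 * ‖z‖ ^ 2) ^ 2) *
          ∫⁻ x in ball z (‖z‖ / 2), ‖(p ^ 2) x‖ₑ := by gcongr
    _ = ∫⁻ x in ball z (‖z‖ / 2), ENNReal.ofReal (1 / (1 + 4 * ‖z‖ ^ 2) ^ 2) * ‖(p ^ 2) x‖ₑ := by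
        rw [lintegral_const_mul' _ _ ENNReal.ofReal_ne_top]
    _ ≤ _ := by
        refine setLIntegral_mono' measurableSet_ball fun x hx => ?_
        have h1 : ‖x‖ ≤ 2 * ‖z‖ := by
          have := norm_sub_norm_le x z
          rw [mem_ball, dist_eq_norm] at hx
          linarith
        have h2 : ‖x‖ ^ 2 ≤ 4 * ‖z‖ ^ 2 := by nlinarith [norm_nonneg x]
        simp only [Pi.mul_apply, Pi.pow_apply, enorm_pow]
        unfold fsDensity
        gcongr

/-- Absolute continuity of the integral: the balls have vanishing Fubini–Study area along `l`, so
the integrals of `|p|²` over them vanish too. Taking `l` at `0` gives `|p| = o(1 / |z|)`, and at `∞`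
it gives `|p| = o(|z|)`: exactly what removability of the two singularities requires. -/
theorem tendsto_norm_mul_norm_div {p : ℂ → ℂ} (hp : DifferentiableOn ℂ p {0}ᶜ)
    (hint : ∫⁻ z, ‖p z‖ₑ ^ 2 ∂fsMeasure ≠ ⊤) {l : Filter ℂ} (hl : ∀ᶠ z in l, z ≠ 0)
    (hl' : Tendsto (fun z : ℂ => ‖z‖ ^ 2 / 4 / (1 + ‖z‖ ^ 2 / 4) ^ 2) l (𝓝 0)) :
    Tendsto (fun z => ‖p z‖ * ‖z‖ / (2 * (1 + 4 * ‖z‖ ^ 2))) l (𝓝 0) := by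
  have h1 : Tendsto (fun z : ℂ => fsMeasure (ball z (‖z‖ / 2))) l (𝓝 0) := by
    have : Tendsto (fun z : ℂ => ENNReal.ofReal (Real.pi * (‖z‖ ^ 2 / 4 / (1 + ‖z‖ ^ 2 / 4) ^ 2)))
        l (𝓝 0) := by
      simpa using ENNReal.tendsto_ofReal (hl'.const_mul Real.pi)
    exact tendsto_of_tendsto_of_tendsto_of_le_of_le' tendsto_const_nhds this
      (Eventually.of_forall fun _ => zero_le) (hl.mono fun z hz => fsMeasure_ball_le hz)
  have h2 := tendsto_setLIntegral_zero hint h1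
  have h3 : Tendsto (fun z => ENNReal.ofReal ((‖p z‖ * ‖z‖ / (2 * (1 + 4 * ‖z‖ ^ 2))) ^ 2)) l
      (𝓝 0) :=
    tendsto_of_tendsto_of_tendsto_of_le_of_le' tendsto_const_nhds h2
      (Eventually.of_forall fun _ => zero_le)
      (hl.mono fun z hz => le_lintegral_fsMeasure_ball hp hz)
  have h4 := (ENNReal.tendsto_toReal ENNReal.zero_ne_top).comp h3
  have h5 := (Real.continuous_sqrt.tendsto _).comp h4
  simp only [ENNReal.toReal_zero, Real.sqrt_zero] at h5
  refine h5.congr fun z => ?_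
  simp only [Function.comp]
  rw [ENNReal.toReal_ofReal (by positivity), Real.sqrt_sq (by positivity)]

theorem isLittleO_inv_of_tendsto {p : ℂ → ℂ}
    (h : Tendsto (fun z => ‖p z‖ * ‖z‖) (𝓝[≠] 0) (𝓝 0)) (a : ℂ) :
    (fun z => p z - a) =o[𝓝[≠] 0] fun z => (z - 0)⁻¹ := by
  have hz : Tendsto (fun z : ℂ => z) (𝓝[≠] 0) (𝓝 0) := tendsto_nhdsWithin_of_tendsto_nhds tendsto_id
  rw [Asymptotics.isLittleO_iff_tendsto']
  · simp only [sub_zero, div_inv_eq_mul, sub_mul]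
    have h1 : Tendsto (fun z => p z * z) (𝓝[≠] 0) (𝓝 0) := by
      rw [tendsto_zero_iff_norm_tendsto_zero]
      simpa using h
    simpa using h1.sub (hz.const_mul a)
  · filter_upwards [self_mem_nhdsWithin] with z hz h0
    simp_all

/-- A holomorphic function on `ℂ \ {0}` that is square integrable for the Fubini–Study area
is constant. -/
theorem eq_of_lintegral_fsMeasure_ne_top {p : ℂ → ℂ} (hp : DifferentiableOn ℂ p {0}ᶜ)
    (hint : ∫⁻ z, ‖p z‖ₑ ^ 2 ∂fsMeasure ≠ ⊤) {z : ℂ} (hz : z ≠ 0) : p z = p 1 := by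
  have hn : Tendsto (fun z : ℂ => ‖z‖) (𝓝[≠] 0) (𝓝 0) :=
    tendsto_nhdsWithin_of_tendsto_nhds (by simpa using (continuous_norm (E := ℂ)).tendsto 0)
  have hinv : Tendsto (fun z : ℂ => z⁻¹) (𝓝[≠] 0) (cocompact ℂ) := by
    rw [← Metric.cobounded_eq_cocompact]
    exact tendsto_inv₀_nhdsNE_zero
  have h0 : Tendsto (fun z => ‖p z‖ * ‖z‖) (𝓝[≠] 0) (𝓝 0) := by
    have h1 := tendsto_norm_mul_norm_div hp hint (l := 𝓝[≠] 0) self_mem_nhdsWithin (by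
      have : Continuous fun t : ℝ => t ^ 2 / 4 / (1 + t ^ 2 / 4) ^ 2 := by
        refine Continuous.div₀ (by fun_prop) (by fun_prop) fun t => by positivity
      simpa [Function.comp_def] using (this.tendsto 0).comp hn)
    have h2 : Tendsto (fun z : ℂ => 2 * (1 + 4 * ‖z‖ ^ 2)) (𝓝[≠] 0) (𝓝 (2 * (1 + 4 * 0 ^ 2))) :=
      ((((hn.pow 2).const_mul 4).const_add 1).const_mul 2)
    simpa using (h1.mul h2).congr fun z => div_mul_cancel₀ _ (by positivity)
  have hinf : Tendsto (fun z => ‖p z⁻¹‖ * ‖z‖) (𝓝[≠] 0) (𝓝 0) := by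
    have h1 := tendsto_norm_mul_norm_div hp hint (l := map (fun z : ℂ => z⁻¹) (𝓝[≠] 0))
      (by
        rw [eventually_map]
        filter_upwards [self_mem_nhdsWithin] with z hz
        simpa using hz)
      (by
        rw [tendsto_map'_iff]
        have : Continuous fun t : ℝ => 4 * t ^ 2 / (4 * t ^ 2 + 1) ^ 2 := by
          refine Continuous.div₀ (by fun_prop) (by fun_prop) fun t => by positivity
        have h := (this.tendsto 0).comp hn
        simp only [ne_eq, OfNat.ofNat_ne_zero, not_false_eq_true, zero_pow, mul_zero, zero_div] at h
        refine h.congr' ?_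
        filter_upwards [self_mem_nhdsWithin] with z hz
        have : ‖z‖ ≠ 0 := by simpa using hz
        simp only [Function.comp, norm_inv]
        field_simp)
    rw [tendsto_map'_iff] at h1
    have h2 : Tendsto (fun z : ℂ => 2 * (‖z‖ ^ 2 + 4)) (𝓝[≠] 0) (𝓝 (2 * (0 ^ 2 + 4))) :=
      (((hn.pow 2).add_const 4).const_mul 2)
    have h3 := h1.mul h2
    rw [zero_mul] at h3
    refine h3.congr' ?_
    filter_upwards [self_mem_nhdsWithin] with z hz
    have : ‖z‖ ≠ 0 := by simpa using hz
    simp only [Function.comp, norm_inv]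
    field_simp
  -- `P` fills the singularity at `0` and is entire; removing the singularity of `q z = p (1/z)` at
  -- `0` gives `P` a finite limit at `∞`, and Liouville applies.
  let P := Function.update p 0 (limUnder (𝓝[≠] 0) p)
  have hP : Differentiable ℂ P := by
    rw [← differentiableOn_univ]
    refine Complex.differentiableOn_update_limUnder_of_isLittleO univ_mem ?_
      (isLittleO_inv_of_tendsto h0 _)
    rwa [← compl_eq_univ_sdiff]
  have hPne : ∀ w ≠ 0, P w = p w := fun w hw => Function.update_of_ne hw _ _
  let q : ℂ → ℂ := fun z => p z⁻¹
  have hq : ∀ᶠ z in 𝓝[≠] (0 : ℂ), DifferentiableAt ℂ q z := by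
    filter_upwards [self_mem_nhdsWithin] with z hz
    have hz : z ≠ 0 := hz
    exact ((hp z⁻¹ (by simpa using hz)).differentiableAt
      (isOpen_compl_singleton.mem_nhds (by simpa using hz))).comp z (differentiableAt_inv hz)
  have hlim := Complex.tendsto_limUnder_of_differentiable_on_punctured_nhds_of_isLittleO hq
    (isLittleO_inv_of_tendsto hinf _)
  have hPlim : Tendsto P (cocompact ℂ) (𝓝 (limUnder (𝓝[≠] 0) q)) := by
    have hi : Tendsto (fun z : ℂ => z⁻¹) (cocompact ℂ) (𝓝[≠] 0) := by
      rw [← Metric.cobounded_eq_cocompact]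
      exact tendsto_inv₀_cobounded'
    refine (hlim.comp hi).congr' ?_
    have : ∀ᶠ z in cocompact ℂ, z ≠ 0 :=
      (isCompact_singleton (x := (0 : ℂ))).compl_mem_cocompact
    filter_upwards [this] with z hz
    simp [q, hPne z hz]
  rw [← hPne z hz, ← hPne 1 one_ne_zero, hP.apply_eq_of_tendsto_cocompact z hPlim,
    hP.apply_eq_of_tendsto_cocompact 1 hPlim]

/-! ### The group `Γ_β`, the invariant measure of `ℂ^*` and its fundamental rings. -/

theorem one_lt_exp_two_pi_mul {β : ℝ} (hβ : 0 < β) : 1 < Real.exp (2 * Real.pi * β) :=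
  Real.one_lt_exp_iff.2 (by positivity)

theorem proj_eq_iff {β : ℝ} {w w' : ℂ} (hw : w ≠ 0) (hw' : w' ≠ 0) :
    proj β w = proj β w' ↔ ∃ k : ℤ, w' = (Real.exp (2 * Real.pi * β) : ℂ) ^ k * w := by
  rw [proj, proj, dif_neg hw, dif_neg hw', QuotientGroup.eq, Gam, Subgroup.mem_zpowers_iff]
  refine exists_congr fun k => ?_
  rw [eq_inv_mul_iff_mul_eq, Units.ext_iff, eq_comm]
  push_cast
  simp [mul_comm]

theorem proj_zpow_mul {β : ℝ} (k : ℤ) (w : ℂ) :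
    proj β ((Real.exp (2 * Real.pi * β) : ℂ) ^ k * w) = proj β w := by
  rcases eq_or_ne w 0 with rfl | hw
  · simp
  · refine ((proj_eq_iff hw (mul_ne_zero (zpow_ne_zero _ ?_) hw)).2 ⟨k, rfl⟩).symm
    exact_mod_cast (Real.exp_pos _).ne'

/-- The invariant measure `dλ(w) / |w|²` of `ℂ^*`. -/
def mulMeasure : Measure ℂ := volume.withDensity fun w => ENNReal.ofReal (1 / ‖w‖ ^ 2)

theorem measurable_mulDensity : Measurable fun w : ℂ => ENNReal.ofReal (1 / ‖w‖ ^ 2) := by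
  fun_prop

theorem lintegral_mulMeasure (q : ℂ → ENNReal) :
    ∫⁻ w, q w ∂mulMeasure = ∫⁻ w, ENNReal.ofReal (1 / ‖w‖ ^ 2) * q w := by
  rw [mulMeasure, lintegral_withDensity_eq_lintegral_mul_non_measurable _ measurable_mulDensity
    (by simp)]
  rfl

/-- The Jacobian `|c|²` cancels against the density `1 / |w|²`. -/
theorem lintegral_mulMeasure_comp_mul_left (q : ℂ → ENNReal) {c : ℂ} (hc : c ≠ 0) :
    ∫⁻ w, q (c * w) ∂mulMeasure = ∫⁻ w, q w ∂mulMeasure := by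
  rw [lintegral_mulMeasure, lintegral_mulMeasure,
    lintegral_comp_mul_left (fun w => ENNReal.ofReal (1 / ‖w‖ ^ 2) * q w) hc,
    ← lintegral_const_mul' _ _ (by simp)]
  refine lintegral_congr fun w => ?_
  rw [← mul_assoc, ← ofReal_norm, ← ENNReal.ofReal_pow (norm_nonneg _),
    ← ENNReal.ofReal_mul (by positivity), norm_mul]
  have : ‖c‖ ≠ 0 := norm_ne_zero_iff.2 hc
  have h : ‖c‖ ^ 2 * (1 / (‖c‖ * ‖w‖) ^ 2) = 1 / ‖w‖ ^ 2 := by field_simp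
  rw [h]

instance : SFinite mulMeasure := by unfold mulMeasure; infer_instance

instance : SFinite fsMeasure := by unfold fsMeasure; infer_instance

theorem ae_mulMeasure_ne_zero : ∀ᵐ w ∂mulMeasure, w ≠ 0 :=
  (withDensity_absolutelyContinuous volume _).ae_le
    (compl_mem_ae_iff.2 (measure_singleton (0 : ℂ)))

theorem ae_fsMeasure_ne_zero : ∀ᵐ w ∂fsMeasure, w ≠ 0 :=
  (withDensity_absolutelyContinuous volume _).ae_le
    (compl_mem_ae_iff.2 (measure_singleton (0 : ℂ)))

instance {β : ℝ} : Countable (Gam β) := by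
  unfold Gam
  infer_instance

instance {β : ℝ} : SMulInvariantMeasure (Gam β) ℂ mulMeasure where
  measure_preimage_smul g s hs := by
    have h := lintegral_mulMeasure_comp_mul_left (s.indicator 1) (g : ℂˣ).ne_zero
    rw [lintegral_indicator_one hs, ← lintegral_indicator_one (measurableSet_preimage
      (measurable_const_smul g) hs)] at *
    exact h

/-- The annulus `c ≤ |w| < c e^{2πβ}`. -/
def fundRing (β c : ℝ) : Set ℂ := {w | c ≤ ‖w‖ ∧ ‖w‖ < c * Real.exp (2 * Real.pi * β)}

theorem measurableSet_fundRing (β c : ℝ) : MeasurableSet (fundRing β c) :=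
  (measurableSet_le measurable_const measurable_norm).inter
    (measurableSet_lt measurable_norm measurable_const)

theorem coe_gam {β : ℝ} (g : Gam β) :
    ∃ k : ℤ, (Units.mk0 (Complex.exp (2 * Real.pi * β)) (Complex.exp_ne_zero _)) ^ k = (g : ℂˣ) ∧
      ((g : ℂˣ) : ℂ) = (Real.exp (2 * Real.pi * β) : ℂ) ^ k := by
  obtain ⟨k, hk⟩ := Subgroup.mem_zpowers_iff.1 g.2
  refine ⟨k, hk, ?_⟩
  rw [← hk]
  push_cast
  simp

/-- With `R = e^{2πβ}`, the half-open ring gives `R^m c ≤ R^m ‖a‖ = R^n ‖b‖ < R^(n+1) c`, hence `m <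
n + 1`. -/
theorem zpow_le_of_mem_fundRing {β c : ℝ} (hβ : 0 < β) (hc : 0 < c) {m n : ℤ} {a b : ℂ}
    (ha : a ∈ fundRing β c) (hb : b ∈ fundRing β c)
    (hab : Real.exp (2 * Real.pi * β) ^ m * ‖a‖ = Real.exp (2 * Real.pi * β) ^ n * ‖b‖) :
    m ≤ n := by
  have hR := one_lt_exp_two_pi_mul hβ
  have hm : 0 < Real.exp (2 * Real.pi * β) ^ m := by positivity
  have hn : 0 < Real.exp (2 * Real.pi * β) ^ n := by positivity
  have : Real.exp (2 * Real.pi * β) ^ m < Real.exp (2 * Real.pi * β) ^ (n + 1) := by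
    rw [zpow_add_one₀ (by positivity)]
    refine lt_of_mul_lt_mul_right ?_ hc.le
    calc _ ≤ Real.exp (2 * Real.pi * β) ^ m * ‖a‖ := by gcongr; exact ha.1
      _ = Real.exp (2 * Real.pi * β) ^ n * ‖b‖ := hab
      _ < Real.exp (2 * Real.pi * β) ^ n * (c * Real.exp (2 * Real.pi * β)) := by
        gcongr; exact hb.2
      _ = _ := by rw [mul_comm c, ← mul_assoc]
  exact Int.lt_add_one_iff.1 ((zpow_lt_zpow_iff_right₀ hR).1 this)

theorem zpow_unique_of_mem_fundRing {β c : ℝ} (hβ : 0 < β) (hc : 0 < c) {m n : ℤ} {a b : ℂ}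
    (ha : a ∈ fundRing β c) (hb : b ∈ fundRing β c)
    (hab : Real.exp (2 * Real.pi * β) ^ m * ‖a‖ = Real.exp (2 * Real.pi * β) ^ n * ‖b‖) :
    m = n :=
  le_antisymm (zpow_le_of_mem_fundRing hβ hc ha hb hab)
    (zpow_le_of_mem_fundRing hβ hc hb ha hab.symm)

theorem norm_zpow_mul (β : ℝ) (k : ℤ) (w : ℂ) :
    ‖(Real.exp (2 * Real.pi * β) : ℂ) ^ k * w‖ = Real.exp (2 * Real.pi * β) ^ k * ‖w‖ := by
  rw [norm_mul, norm_zpow, Complex.norm_real, Real.norm_of_nonneg (by positivity)]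

theorem exists_zpow_mul_mem_fundRing {β c : ℝ} (hβ : 0 < β) (hc : 0 < c) {w : ℂ} (hw : w ≠ 0) :
    ∃ k : ℤ, (Real.exp (2 * Real.pi * β) : ℂ) ^ k * w ∈ fundRing β c := by
  have hw' : 0 < ‖w‖ := norm_pos_iff.2 hw
  obtain ⟨k, h1, h2⟩ := exists_mem_Ico_zpow (div_pos hw' hc) (one_lt_exp_two_pi_mul hβ)
  have hRk : 0 < Real.exp (2 * Real.pi * β) ^ k := by positivity
  rw [le_div_iff₀ hc] at h1
  rw [div_lt_iff₀ hc, zpow_add_one₀ (by positivity)] at h2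
  refine ⟨-k, ?_, ?_⟩
  · rw [norm_zpow_mul, zpow_neg, le_inv_mul_iff₀ hRk]
    exact h1
  · rw [norm_zpow_mul, zpow_neg, inv_mul_lt_iff₀ hRk]
    linarith

theorem isFundamentalDomain_fundRing {β c : ℝ} (hβ : 0 < β) (hc : 0 < c) :
    IsFundamentalDomain (Gam β) (fundRing β c) mulMeasure where
  nullMeasurableSet := (measurableSet_fundRing β c).nullMeasurableSet
  ae_covers := by
    filter_upwards [ae_mulMeasure_ne_zero] with w hw
    obtain ⟨k, hk⟩ := exists_zpow_mul_mem_fundRing hβ hc hw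
    obtain ⟨g, hg⟩ : ∃ g : Gam β, g • w = (Real.exp (2 * Real.pi * β) : ℂ) ^ k * w := by
      refine ⟨⟨Units.mk0 (Complex.exp (2 * Real.pi * β)) (Complex.exp_ne_zero _) ^ k,
        Subgroup.zpow_mem_zpowers _ _⟩, ?_⟩
      change ((Units.mk0 (Complex.exp (2 * Real.pi * β)) (Complex.exp_ne_zero _) ^ k : ℂˣ) : ℂ)
        * w = _
      push_cast
      simp
    exact ⟨g, hg ▸ hk⟩
  aedisjoint := by
    intro g g' hg
    refine Disjoint.aedisjoint (Set.disjoint_left.2 ?_)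
    rintro x ⟨y, hy, rfl⟩ ⟨y', hy', hyy⟩
    apply hg
    obtain ⟨k, hk, hk'⟩ := coe_gam g
    obtain ⟨l, hl, hl'⟩ := coe_gam g'
    have h : Real.exp (2 * Real.pi * β) ^ l * ‖y'‖ = Real.exp (2 * Real.pi * β) ^ k * ‖y‖ := by
      have h1 : ((g' : ℂˣ) : ℂ) * y' = ((g : ℂˣ) : ℂ) * y := hyy
      have h2 := congrArg norm h1
      rwa [hk', hl', norm_zpow_mul, norm_zpow_mul] at h2
    have hkl : k = l := zpow_unique_of_mem_fundRing hβ hc hy hy' h.symm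
    exact Subtype.ext (by rw [← hk, ← hl, hkl])

/-- Multiplication by `c` carries the ring of inner radius `1` to the ring of inner radius `‖c‖`.
Both are fundamental domains of `Γ_β`, so an invariant `q` has the same integral over each. -/
theorem lintegral_fundRing_comp_mul_left {β : ℝ} (hβ : 0 < β) {q : ℂ → ENNReal}
    (hq : ∀ (k : ℤ) w, q ((Real.exp (2 * Real.pi * β) : ℂ) ^ k * w) = q w) {c : ℂ} (hc : c ≠ 0) :
    ∫⁻ w in fundRing β 1, q (c * w) ∂mulMeasure = ∫⁻ w in fundRing β 1, q w ∂mulMeasure := by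
  have hc' : 0 < ‖c‖ := norm_pos_iff.2 hc
  have hset : ∀ w, c * w ∈ fundRing β ‖c‖ ↔ w ∈ fundRing β 1 := by
    intro w
    simp only [fundRing, mem_ofPred_eq, norm_mul, one_mul, le_mul_iff_one_le_right hc',
      mul_lt_mul_iff_right₀ hc']
  calc ∫⁻ w in fundRing β 1, q (c * w) ∂mulMeasure
      = ∫⁻ w, (fundRing β ‖c‖).indicator q (c * w) ∂mulMeasure := by
        rw [← lintegral_indicator (measurableSet_fundRing β 1)]
        refine lintegral_congr fun w => ?_
        by_cases hw : w ∈ fundRing β 1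
        · rw [indicator_of_mem hw, indicator_of_mem ((hset w).2 hw)]
        · rw [indicator_of_notMem hw, indicator_of_notMem fun h => hw ((hset w).1 h)]
    _ = ∫⁻ w in fundRing β ‖c‖, q w ∂mulMeasure := by
        rw [lintegral_mulMeasure_comp_mul_left _ hc, lintegral_indicator (measurableSet_fundRing _ _)]
    _ = _ := by
        refine (isFundamentalDomain_fundRing hβ hc').setLIntegral_eq
          (isFundamentalDomain_fundRing hβ one_pos) q fun g x => ?_
        obtain ⟨k, -, hk⟩ := coe_gam g
        have : g • x = ((g : ℂˣ) : ℂ) * x := rfl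
        rw [this, hk, hq]

/-! ### The volume of `X` as a product measure. -/

theorem coordVol_eq_prod (β : ℝ) :
    coordVol β = fsMeasure.prod (mulMeasure.restrict (fundRing β 1)) := by
  have hfd : fundDom β = univ ×ˢ fundRing β 1 := by
    ext x
    simp [fundDom, fundRing]
  rw [coordVol, hfd, Measure.volume_eq_prod, ← Measure.prod_restrict, Measure.restrict_univ,
    mulMeasure, restrict_withDensity (measurableSet_fundRing β 1), fsMeasure,
    prod_withDensity measurable_fsDensity measurable_mulDensity]
  congr 1
  funext x
  rw [fsDensity, ← ENNReal.ofReal_mul (by positivity)]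
  congr 1
  field_simp

/-- For each `z ≠ 0` the substitution `w = (ε z)⁻¹ u` leaves the integral over the fundamental ring
unchanged; Tonelli then puts the `z`-integral inside, along the curves of constant `u = ε z w`. -/
theorem lintegral_coordVol {β : ℝ} (hβ : 0 < β) {Q : ℂ × ℂ → ENNReal} (hQ : Measurable Q)
    (hQi : ∀ (k : ℤ) z w, Q (z, (Real.exp (2 * Real.pi * β) : ℂ) ^ k * w) = Q (z, w))
    {ε : ℂ} (hε : ε ≠ 0) :
    ∫⁻ x, Q x ∂coordVol β =
      ∫⁻ u in fundRing β 1, (∫⁻ z, Q (z, (ε * z)⁻¹ * u) ∂fsMeasure) ∂mulMeasure := by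
  rw [coordVol_eq_prod, lintegral_prod _ hQ.aemeasurable]
  refine Eq.trans ?_ (lintegral_lintegral_swap (f := fun z u => Q (z, (ε * z)⁻¹ * u)) ?_)
  · refine lintegral_congr_ae ?_
    filter_upwards [ae_fsMeasure_ne_zero] with z hz
    exact (lintegral_fundRing_comp_mul_left hβ (q := fun w => Q (z, w)) (fun k w => hQi k z w)
      (inv_ne_zero (mul_ne_zero hε hz))).symm
  · exact (hQ.comp (by fun_prop)).aemeasurable

theorem fsMeasure_univ_lt_top : fsMeasure univ < ⊤ := by
  have h := (integrable_rpow_neg_one_add_norm_sq (E := ℂ) (μ := volume) (r := 4)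
    (by rw [Complex.finrank_real_complex]; norm_num)).lintegral_lt_top
  rw [fsMeasure, withDensity_apply _ MeasurableSet.univ, Measure.restrict_univ]
  convert! h using 3 with z
  unfold fsDensity
  congr 1
  rw [show (-4 / 2 : ℝ) = -(2 : ℕ) by norm_num, Real.rpow_neg (by positivity), Real.rpow_natCast,
    one_div]

theorem volume_absolutelyContinuous_fsMeasure : (volume : Measure ℂ) ≪ fsMeasure :=
  withDensity_absolutelyContinuous' measurable_fsDensity.aemeasurable
    (Eventually.of_forall fun z => by
      simp only [fsDensity, ne_eq, ENNReal.ofReal_eq_zero, not_le]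
      positivity)

theorem fsMeasure_univ_ne_zero : fsMeasure univ ≠ 0 := fun h => by
  have := volume_absolutelyContinuous_fsMeasure h
  simp at this

theorem volume_absolutelyContinuous_mulMeasure : (volume : Measure ℂ) ≪ mulMeasure :=
  withDensity_absolutelyContinuous' measurable_mulDensity.aemeasurable
    (by
      have h : ∀ᵐ w : ℂ, w ≠ 0 := compl_mem_ae_iff.2 (measure_singleton (0 : ℂ))
      filter_upwards [h] with w hw
      have : 0 < ‖w‖ := norm_pos_iff.2 hw
      simp only [ne_eq, ENNReal.ofReal_eq_zero, not_le]
      positivity)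

/-! ### The half-plane and the sectors `Re (ε z w) > 0`. -/

/-- The right half-plane. -/
def halfPlane : Set ℂ := {u | 0 < u.re}

theorem isOpen_halfPlane : IsOpen halfPlane := isOpen_lt continuous_const Complex.continuous_re

theorem isPreconnected_halfPlane : IsPreconnected halfPlane :=
  (convex_halfSpace_re_gt 0).isPreconnected

theorem ne_zero_of_mem_halfPlane {u : ℂ} (hu : u ∈ halfPlane) : u ≠ 0 := by
  rintro rfl
  simp [halfPlane] at hu

theorem zpow_mul_mem_halfPlane_iff {β : ℝ} (k : ℤ) {u : ℂ} :
    (Real.exp (2 * Real.pi * β) : ℂ) ^ k * u ∈ halfPlane ↔ u ∈ halfPlane := by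
  have : 0 < Real.exp (2 * Real.pi * β) ^ k := by positivity
  rw [halfPlane, mem_ofPred_eq, mem_ofPred_eq, ← Complex.ofReal_zpow, Complex.re_ofReal_mul,
    mul_pos_iff_of_pos_left this]

/-- The domain `{(z, [w]) : Re (ε z w) > 0}`. -/
def sector (β : ℝ) (ε : ℂ) : Set (Surface β) :=
  {p | ∃ z w : ℂ, w ≠ 0 ∧ ε * z * w ∈ halfPlane ∧ p = ((z : OnePoint ℂ), proj β w)}

theorem mem_sector_iff {β : ℝ} {ε z w : ℂ} (hw : w ≠ 0) :
    ((z : OnePoint ℂ), proj β w) ∈ sector β ε ↔ ε * z * w ∈ halfPlane := by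
  refine ⟨?_, fun h => ⟨z, w, hw, h, rfl⟩⟩
  rintro ⟨z', w', hw', h, he⟩
  obtain ⟨h1, h2⟩ := Prod.ext_iff.1 he
  have hz : z = z' := OnePoint.coe_injective h1
  obtain ⟨k, hk⟩ := (proj_eq_iff hw hw').1 h2
  rw [← hz, hk, mul_left_comm, zpow_mul_mem_halfPlane_iff] at h
  exact h

theorem infty_notMem_sector {β : ℝ} {ε : ℂ} (e : EllCurve β) :
    ((OnePoint.infty : OnePoint ℂ), e) ∉ sector β ε := by
  rintro ⟨z, w, -, -, he⟩
  exact OnePoint.infty_ne_coe z (Prod.ext_iff.1 he).1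

theorem coordDom_false_sector (β : ℝ) (ε : ℂ) :
    coordDom β false (sector β ε) = {x | ε * x.1 * x.2 ∈ halfPlane} := by
  ext x
  constructor
  · rintro ⟨h1, h2⟩
    exact (mem_sector_iff h1).1 h2
  · intro h
    have hw := right_ne_zero_of_mul (ne_zero_of_mem_halfPlane h)
    exact ⟨hw, (mem_sector_iff hw).2 h⟩

theorem param_true_of_ne_zero {β : ℝ} {x : ℂ × ℂ} (hx : x.1 ≠ 0) :
    param β true x = param β false (x.1⁻¹, x.2) := by
  simp [param, affine, hx]

theorem coordDom_true_sector (β : ℝ) (ε : ℂ) :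
    coordDom β true (sector β ε) = {x | ε * x.1⁻¹ * x.2 ∈ halfPlane} := by
  ext x
  rcases eq_or_ne x.1 0 with hx | hx
  · simp only [coordDom, mem_ofPred_eq, hx, inv_zero, mul_zero, zero_mul]
    refine iff_of_false (fun h => ?_) fun h => ne_zero_of_mem_halfPlane h rfl
    have h2 := h.2
    rw [param, hx, affine, if_pos rfl] at h2
    exact infty_notMem_sector _ h2
  · have h := Set.ext_iff.1 (coordDom_false_sector β ε) (x.1⁻¹, x.2)
    simp only [coordDom, mem_ofPred_eq] at h ⊢
    rw [param_true_of_ne_zero hx, h]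

theorem isOpen_coordDom_false_sector (β : ℝ) (ε : ℂ) :
    IsOpen (coordDom β false (sector β ε)) := by
  rw [coordDom_false_sector]
  exact isOpen_halfPlane.preimage (by fun_prop)

theorem isOpen_coordDom_true_sector (β : ℝ) (ε : ℂ) :
    IsOpen (coordDom β true (sector β ε)) := by
  have : coordDom β true (sector β ε) =
      {x : ℂ × ℂ | x.1 ≠ 0} ∩ (fun x : ℂ × ℂ => ε * x.1⁻¹ * x.2) ⁻¹' halfPlane := by
    rw [coordDom_true_sector]
    ext x
    simp only [mem_ofPred_eq, mem_inter_iff, mem_preimage, iff_and_self]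
    rintro h hx
    rw [hx, inv_zero, mul_zero, zero_mul] at h
    exact ne_zero_of_mem_halfPlane h rfl
  rw [this]
  refine ContinuousOn.isOpen_inter_preimage ?_ (isOpen_ne_fun continuous_fst continuous_const)
    isOpen_halfPlane
  exact (continuousOn_const.mul (continuousOn_fst.inv₀ fun x hx => hx)).mul continuousOn_snd

theorem isOpen_coordDom_sector (β : ℝ) (ε : ℂ) (c : Bool) :
    IsOpen (coordDom β c (sector β ε)) := by
  cases c
  exacts [isOpen_coordDom_false_sector β ε, isOpen_coordDom_true_sector β ε]

/-! ### Reduction of `L²` holomorphic functions to the coordinate `ε z w`. -/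

/-- `f` is, on the sector, the function `g` of the invariant coordinate `ε z w`. -/
def FactorsThrough {β : ℝ} (f : Surface β → ℂ) (ε : ℂ) (g : ℂ → ℂ) : Prop :=
  ∀ z w : ℂ, ε * z * w ∈ halfPlane → f (param β false (z, w)) = g (ε * z * w)

theorem FactorsThrough.holomorphicOn {β : ℝ} {f : Surface β → ℂ} {ε : ℂ} {g : ℂ → ℂ}
    (h : FactorsThrough f ε g) (hg : DifferentiableOn ℂ g halfPlane) :
    HolomorphicOn f (sector β ε) := by
  rintro (_ | _)
  · rw [coordDom_false_sector]
    refine DifferentiableOn.congr (f := fun x : ℂ × ℂ => g (ε * x.1 * x.2)) ?_ fun x hx => h _ _ hx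
    exact hg.comp (f := fun x : ℂ × ℂ => ε * x.1 * x.2) (by fun_prop) fun x hx => hx
  · rw [coordDom_true_sector]
    have hne : ∀ x ∈ {x : ℂ × ℂ | ε * x.1⁻¹ * x.2 ∈ halfPlane}, x.1 ≠ 0 := by
      rintro x hx h0
      rw [mem_ofPred_eq, h0, inv_zero, mul_zero, zero_mul] at hx
      exact ne_zero_of_mem_halfPlane hx rfl
    refine DifferentiableOn.congr (f := fun x : ℂ × ℂ => g (ε * x.1⁻¹ * x.2)) ?_ fun x hx => ?_
    · refine hg.comp (f := fun x : ℂ × ℂ => ε * x.1⁻¹ * x.2) ?_ fun x hx => hx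
      exact ((differentiableOn_fst.inv hne).const_mul ε).mul differentiableOn_snd
    · rw [param_true_of_ne_zero (hne x hx)]
      exact h _ _ hx

/-- The density `|f|²` on the sector, in the coordinates `(z, w)`. -/
def sqDensity {β : ℝ} (f : Surface β → ℂ) (ε : ℂ) : ℂ × ℂ → ENNReal :=
  (coordDom β false (sector β ε)).indicator fun x => ‖f (param β false x)‖ₑ ^ 2

theorem HolomorphicOn.continuousOn_false {β : ℝ} {f : Surface β → ℂ} {ε : ℂ}
    (h : HolomorphicOn f (sector β ε)) :
    ContinuousOn (fun x => f (param β false x)) (coordDom β false (sector β ε)) :=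
  (h false).continuousOn

theorem HolomorphicOn.measurable_sqDensity {β : ℝ} {f : Surface β → ℂ} {ε : ℂ}
    (h : HolomorphicOn f (sector β ε)) : Measurable (sqDensity f ε) := by
  classical
  have h1 : ContinuousOn (fun x => ‖f (param β false x)‖ₑ ^ 2) (coordDom β false (sector β ε)) :=
    (ENNReal.continuous_pow 2).comp_continuousOn h.continuousOn_false.enorm
  rw [sqDensity, ← piecewise_eq_indicator]
  exact h1.measurable_piecewise continuousOn_const
    (isOpen_coordDom_false_sector β ε).measurableSet

theorem param_zpow_mul {β : ℝ} (c : Bool) (k : ℤ) (z w : ℂ) :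
    param β c (z, (Real.exp (2 * Real.pi * β) : ℂ) ^ k * w) = param β c (z, w) := by
  rw [param, param, proj_zpow_mul]

theorem sqDensity_zpow_mul {β : ℝ} (f : Surface β → ℂ) (ε : ℂ) (k : ℤ) (z w : ℂ) :
    sqDensity f ε (z, (Real.exp (2 * Real.pi * β) : ℂ) ^ k * w) = sqDensity f ε (z, w) := by
  have h2 : (z, (Real.exp (2 * Real.pi * β) : ℂ) ^ k * w) ∈ coordDom β false (sector β ε) ↔
      (z, w) ∈ coordDom β false (sector β ε) := by
    rw [coordDom_false_sector]
    simp only [mem_ofPred_eq]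
    rw [mul_left_comm, zpow_mul_mem_halfPlane_iff]
  by_cases h : (z, w) ∈ coordDom β false (sector β ε)
  · rw [sqDensity, indicator_of_mem h, indicator_of_mem (h2.2 h), param_zpow_mul]
  · rw [sqDensity, indicator_of_notMem h, indicator_of_notMem fun h' => h (h2.1 h')]

theorem squareIntegrableOn_iff {β : ℝ} (hβ : 0 < β) {f : Surface β → ℂ} {ε : ℂ} (hε : ε ≠ 0)
    (h : HolomorphicOn f (sector β ε)) :
    SquareIntegrableOn f (sector β ε) ↔
      ∫⁻ u in fundRing β 1, (∫⁻ z, sqDensity f ε (z, (ε * z)⁻¹ * u) ∂fsMeasure) ∂mulMeasure < ⊤ := by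
  have hV := (isOpen_coordDom_false_sector β ε).measurableSet
  rw [SquareIntegrableOn, memLp_two_iff_lintegral_enorm_sq
    (h.continuousOn_false.aestronglyMeasurable hV), ← lintegral_indicator hV,
    ← lintegral_coordVol hβ h.measurable_sqDensity (sqDensity_zpow_mul f ε) hε]
  rfl

theorem mul_inv_mul_cancel_of_ne_zero {ε z u : ℂ} (hε : ε ≠ 0) (hz : z ≠ 0) :
    ε * z * ((ε * z)⁻¹ * u) = u := mul_inv_cancel_left₀ (mul_ne_zero hε hz) u

theorem sqDensity_slice {β : ℝ} (f : Surface β → ℂ) {ε z u : ℂ} (hε : ε ≠ 0) (hz : z ≠ 0)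
    (hu : u ∈ halfPlane) :
    sqDensity f ε (z, (ε * z)⁻¹ * u) = ‖f (param β false (z, (ε * z)⁻¹ * u))‖ₑ ^ 2 := by
  rw [sqDensity, indicator_of_mem]
  rw [coordDom_false_sector, mem_ofPred_eq, mul_inv_mul_cancel_of_ne_zero hε hz]
  exact hu

/-- The inner integral is `|g(u)|²` times the total Fubini–Study area; the two directions need that
area to be finite and nonzero respectively. -/
theorem FactorsThrough.squareIntegrableOn_iff {β : ℝ} (hβ : 0 < β) {f : Surface β → ℂ} {ε : ℂ}
    (hε : ε ≠ 0) {g : ℂ → ℂ} (h : FactorsThrough f ε g) (hg : DifferentiableOn ℂ g halfPlane) :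
    SquareIntegrableOn f (sector β ε) ↔
      ∫⁻ u in fundRing β 1 ∩ halfPlane, ‖g u‖ₑ ^ 2 ∂mulMeasure < ⊤ := by
  rw [Ohsawa.squareIntegrableOn_iff hβ hε (h.holomorphicOn hg)]
  have key : ∀ u, ∫⁻ z, sqDensity f ε (z, (ε * z)⁻¹ * u) ∂fsMeasure =
      halfPlane.indicator (fun u => ‖g u‖ₑ ^ 2) u * fsMeasure univ := by
    intro u
    rw [← lintegral_const]
    refine lintegral_congr_ae ?_
    filter_upwards [ae_fsMeasure_ne_zero] with z hz
    by_cases hu : u ∈ halfPlane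
    · rw [sqDensity_slice f hε hz hu, indicator_of_mem hu, h, mul_inv_mul_cancel_of_ne_zero hε hz]
      rwa [mul_inv_mul_cancel_of_ne_zero hε hz]
    · rw [sqDensity, indicator_of_notMem hu, indicator_of_notMem]
      rwa [coordDom_false_sector, mem_ofPred_eq, mul_inv_mul_cancel_of_ne_zero hε hz]
  simp only [key]
  rw [lintegral_mul_const' _ _ fsMeasure_univ_lt_top.ne,
    setLIntegral_indicator isOpen_halfPlane.measurableSet, inter_comm,
    ENNReal.mul_lt_top_iff]
  simp only [fsMeasure_univ_lt_top, fsMeasure_univ_ne_zero, and_true, or_false]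
  exact or_iff_left_of_imp fun h0 => h0 ▸ ENNReal.zero_lt_top

theorem exp_pi_mul_mem_interior {β : ℝ} (hβ : 0 < β) :
    (Real.exp (Real.pi * β) : ℂ) ∈
      {u : ℂ | 1 < ‖u‖ ∧ ‖u‖ < Real.exp (2 * Real.pi * β)} ∩ halfPlane := by
  have h := mul_pos Real.pi_pos hβ
  refine ⟨?_, ?_⟩
  · rw [mem_ofPred_eq, Complex.norm_real, Real.norm_of_nonneg (Real.exp_pos _).le]
    exact ⟨Real.one_lt_exp_iff.2 h, Real.exp_lt_exp.2 (by linarith)⟩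
  · rw [halfPlane, mem_ofPred_eq, Complex.ofReal_re]
    positivity

/-- Continuity removes the null set on the open part of the half-ring, which is nonempty because it
contains `e^{πβ}`; the identity theorem does the rest. -/
theorem eqOn_halfPlane_of_ae_eq {β : ℝ} (hβ : 0 < β) {g₁ g₂ : ℂ → ℂ}
    (h₁ : DifferentiableOn ℂ g₁ halfPlane) (h₂ : DifferentiableOn ℂ g₂ halfPlane)
    (h : ∀ᵐ u, u ∈ fundRing β 1 → u ∈ halfPlane → g₁ u = g₂ u) : EqOn g₁ g₂ halfPlane := by
  let U : Set ℂ := {u : ℂ | 1 < ‖u‖ ∧ ‖u‖ < Real.exp (2 * Real.pi * β)} ∩ halfPlane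
  have hU : IsOpen U := ((isOpen_lt continuous_const continuous_norm).inter
    (isOpen_lt continuous_norm continuous_const)).inter isOpen_halfPlane
  have hUeq : EqOn g₁ g₂ U := by
    refine Measure.eqOn_open_of_ae_eq (μ := volume) ?_ hU
      (h₁.continuousOn.mono inter_subset_right) (h₂.continuousOn.mono inter_subset_right)
    refine (ae_restrict_iff' hU.measurableSet).2 ?_
    filter_upwards [h] with u hu huU
    exact hu ⟨huU.1.1.le, by simpa using huU.1.2⟩ huU.2
  have hp := exp_pi_mul_mem_interior hβ
  exact (h₁.analyticOnNhd isOpen_halfPlane).eqOn_of_preconnected_of_eventuallyEq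
    (h₂.analyticOnNhd isOpen_halfPlane) isPreconnected_halfPlane hp.2
    (hUeq.eventuallyEq_of_mem (hU.mem_nhds hp))

/-- A square integrable holomorphic function on the sector depends only on `ε z w`. -/
theorem exists_factorsThrough {β : ℝ} (hβ : 0 < β) {f : Surface β → ℂ} {ε : ℂ} (hε : ε ≠ 0)
    (hf : HolomorphicOn f (sector β ε)) (hf2 : SquareIntegrableOn f (sector β ε)) :
    ∃ g : ℂ → ℂ, DifferentiableOn ℂ g halfPlane ∧ FactorsThrough f ε g := by
  have hslice : ∀ z ≠ 0, ∀ u ∈ halfPlane, (z, (ε * z)⁻¹ * u) ∈ coordDom β false (sector β ε) := by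
    intro z hz u hu
    rwa [coordDom_false_sector, mem_ofPred_eq, mul_inv_mul_cancel_of_ne_zero hε hz]
  have hu : ∀ z ≠ 0, DifferentiableOn ℂ (fun u => f (param β false (z, (ε * z)⁻¹ * u))) halfPlane :=
    fun z hz => (hf false).comp (f := fun u : ℂ => (z, (ε * z)⁻¹ * u)) (by fun_prop) (hslice z hz)
  have hz : ∀ u ∈ halfPlane,
      DifferentiableOn ℂ (fun z => f (param β false (z, (ε * z)⁻¹ * u))) {0}ᶜ := by
    intro u hu
    refine (hf false).comp (f := fun z : ℂ => (z, (ε * z)⁻¹ * u)) ?_ fun z hz => hslice z hz u hu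
    refine differentiableOn_id.prodMk ?_
    exact ((differentiableOn_id.const_mul ε).inv fun z hz => mul_ne_zero hε hz).mul_const u
  -- For almost every `u` the slice in `z` has finite norm and is constant, so it equals its value
  -- at `z = 1`; the slice `z = 1` will serve as `g`.
  have hae : ∀ᵐ u, u ∈ fundRing β 1 → u ∈ halfPlane → ∀ z ≠ 0,
      f (param β false (z, (ε * z)⁻¹ * u)) = f (param β false (1, (ε * 1)⁻¹ * u)) := by
    have h1 := ae_lt_top' (by
      exact ((hf.measurable_sqDensity.comp
        (by fun_prop : Measurable fun q : ℂ × ℂ => (q.2, (ε * q.2)⁻¹ * q.1))).lintegral_prod_right'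
          (ν := fsMeasure)).aemeasurable) ((squareIntegrableOn_iff hβ hε hf).1 hf2).ne
    have h2 := volume_absolutelyContinuous_mulMeasure.ae_le
      ((ae_restrict_iff' (measurableSet_fundRing β 1)).1 h1)
    filter_upwards [h2] with u h3 hu1 hu2 z hz0
    refine eq_of_lintegral_fsMeasure_ne_top (hz u hu2) (ne_of_lt ?_) hz0
    refine lt_of_eq_of_lt (lintegral_congr_ae ?_) (h3 hu1)
    filter_upwards [ae_fsMeasure_ne_zero] with z hz
    exact (sqDensity_slice f hε hz hu2).symm
  refine ⟨fun u => f (param β false (1, (ε * 1)⁻¹ * u)), hu 1 one_ne_zero, fun z w hzw => ?_⟩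
  have hzw0 := left_ne_zero_of_mul (ne_zero_of_mem_halfPlane hzw)
  have hz0 : z ≠ 0 := right_ne_zero_of_mul hzw0
  -- With `z` now fixed, both sides are holomorphic in `u`, so the exceptional null set disappears.
  have h := eqOn_halfPlane_of_ae_eq hβ (hu z hz0) (hu 1 one_ne_zero) (hae.mono fun u hu h1 h2 =>
    hu h1 h2 z hz0) hzw
  simp only [inv_mul_cancel_left₀ hzw0] at h
  exact h

theorem FactorsThrough.zpow_mul {β : ℝ} {f : Surface β → ℂ} {ε : ℂ} (hε : ε ≠ 0) {g : ℂ → ℂ}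
    (h : FactorsThrough f ε g) (k : ℤ) {u : ℂ} (hu : u ∈ halfPlane) :
    g ((Real.exp (2 * Real.pi * β) : ℂ) ^ k * u) = g u := by
  have h1 := h 1 (ε⁻¹ * u) (by rwa [mul_one, mul_inv_cancel_left₀ hε])
  have he : ε * 1 * ((Real.exp (2 * Real.pi * β) : ℂ) ^ k * (ε⁻¹ * u)) =
      (Real.exp (2 * Real.pi * β) : ℂ) ^ k * u := by field_simp
  have h2 := h 1 ((Real.exp (2 * Real.pi * β) : ℂ) ^ k * (ε⁻¹ * u))
    (by rwa [he, zpow_mul_mem_halfPlane_iff])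
  rw [mul_one, mul_inv_cancel_left₀ hε] at h1
  rw [he, param_zpow_mul] at h2
  rw [← h1, ← h2]

/-! ### The annulus as the quotient of the half-plane by `Γ_β`. -/

/-- The covering `u ↦ exp (-i log u / β)` of the annulus by the right half-plane. -/
def annMap (β : ℝ) (u : ℂ) : ℂ := Complex.exp (-Complex.I * Complex.log u / β)

theorem norm_annMap (β : ℝ) (u : ℂ) : ‖annMap β u‖ = Real.exp (u.arg / β) := by
  rw [annMap, Complex.norm_exp, Complex.div_ofReal_re]
  congr 2
  simp [Complex.log_im]

theorem annMap_mem_annulus {β : ℝ} (hβ : 0 < β) {u : ℂ} (hu : u ∈ halfPlane) :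
    annMap β u ∈ annulus β := by
  have h := abs_lt.1 (Complex.abs_arg_lt_pi_div_two_iff.2 (Or.inl hu))
  have h2 : Real.pi / (2 * β) = Real.pi / 2 / β := by field_simp
  rw [annulus, mem_ofPred_eq, norm_annMap, Real.exp_lt_exp, Real.exp_lt_exp, h2, ← neg_div]
  exact ⟨div_lt_div_of_pos_right h.1 hβ, div_lt_div_of_pos_right h.2 hβ⟩

theorem hasDerivAt_annMap (β : ℝ) {u : ℂ} (hu : u ∈ halfPlane) :
    HasDerivAt (annMap β) (annMap β u * (-Complex.I * u⁻¹ / β)) u :=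
  (((Complex.hasDerivAt_log (Or.inl hu)).const_mul (-Complex.I)).div_const (β : ℂ)).cexp

/-- `L` is an arbitrary logarithm of a point of the annulus, whose radii say precisely that `|β Re
L| < π / 2`. The bound on the imaginary part lets the principal logarithm undo the exponential in
`annMap_exp`. -/
theorem exp_mem_halfPlane {β : ℝ} (hβ : 0 < β) {L : ℂ} (h : Complex.exp L ∈ annulus β) :
    Complex.exp (Complex.I * β * L) ∈ halfPlane ∧ |(Complex.I * β * L).im| < Real.pi / 2 := by
  rw [annulus, mem_ofPred_eq, Complex.norm_exp, Real.exp_lt_exp, Real.exp_lt_exp] at h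
  have h2 : Real.pi / (2 * β) = Real.pi / 2 / β := by field_simp
  rw [h2, ← neg_div, div_lt_iff₀ hβ, lt_div_iff₀ hβ] at h
  have him : (Complex.I * β * L).im = L.re * β := by simp [mul_comm]
  rw [him, abs_lt]
  refine ⟨?_, h⟩
  rw [halfPlane, mem_ofPred_eq, Complex.exp_re, him]
  exact mul_pos (Real.exp_pos _) (Real.cos_pos_of_mem_Ioo h)

theorem annMap_exp {β : ℝ} (hβ : 0 < β) {L : ℂ} (h : Complex.exp L ∈ annulus β) :
    annMap β (Complex.exp (Complex.I * β * L)) = Complex.exp L := by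
  have h1 := abs_lt.1 (exp_mem_halfPlane hβ h).2
  have hβ' : (β : ℂ) ≠ 0 := by exact_mod_cast hβ.ne'
  have hπ := Real.pi_pos
  rw [annMap, Complex.log_exp (by linarith) (by linarith)]
  congr 1
  field_simp
  rw [Complex.I_sq]
  ring

theorem annMap_zpow_mul {β : ℝ} (hβ : 0 < β) (k : ℤ) {u : ℂ} (hu : u ≠ 0) :
    annMap β ((Real.exp (2 * Real.pi * β) : ℂ) ^ k * u) = annMap β u := by
  have hβ' : (β : ℂ) ≠ 0 := by exact_mod_cast hβ.ne'
  rw [annMap, annMap, ← Complex.ofReal_zpow, Complex.log_ofReal_mul (by positivity) hu,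
    Real.log_zpow, Real.log_exp, Complex.exp_eq_exp_iff_exists_int]
  refine ⟨-k, ?_⟩
  push_cast
  field_simp
  ring

/-- Independence of the branch: `2πi n` multiplied by `iβ` is `-2πβ n`, so a change of logarithm
acts through `Γ_β`. -/
theorem exp_eq_zpow_mul_exp (β : ℝ) {L L' : ℂ} (h : Complex.exp L = Complex.exp L') :
    ∃ k : ℤ, Complex.exp (Complex.I * β * L) =
      (Real.exp (2 * Real.pi * β) : ℂ) ^ k * Complex.exp (Complex.I * β * L') := by
  obtain ⟨n, rfl⟩ := Complex.exp_eq_exp_iff_exists_int.1 h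
  refine ⟨-n, ?_⟩
  rw [Complex.ofReal_exp, ← Complex.exp_int_mul, ← Complex.exp_add]
  congr 1
  push_cast
  linear_combination (2 * Real.pi * β * n : ℂ) * Complex.I_sq

theorem exp_log_annMap {β : ℝ} (hβ : 0 < β) {u : ℂ} (hu : u ≠ 0) :
    ∃ k : ℤ, Complex.exp (Complex.I * β * Complex.log (annMap β u)) =
      (Real.exp (2 * Real.pi * β) : ℂ) ^ k * u := by
  have hβ' : (β : ℂ) ≠ 0 := by exact_mod_cast hβ.ne'
  obtain ⟨k, hk⟩ := exp_eq_zpow_mul_exp β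
    (Complex.exp_log (Complex.exp_ne_zero (-Complex.I * Complex.log u / β)))
  refine ⟨k, hk.trans ?_⟩
  have : Complex.I * β * (-Complex.I * Complex.log u / β) = Complex.log u := by
    field_simp
    rw [Complex.I_sq]
    ring
  rw [this, Complex.exp_log hu]

theorem ne_zero_of_mem_annulus {β : ℝ} {W : ℂ} (hW : W ∈ annulus β) : W ≠ 0 :=
  norm_pos_iff.1 ((Real.exp_pos _).trans hW.1)

theorem isOpen_annulus (β : ℝ) : IsOpen (annulus β) :=
  (isOpen_lt continuous_const continuous_norm).inter (isOpen_lt continuous_norm continuous_const)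

theorem injOn_annMap {β : ℝ} (hβ : 0 < β) : InjOn (annMap β) (fundRing β 1 ∩ halfPlane) := by
  intro u hu v hv h
  have hu0 := ne_zero_of_mem_halfPlane hu.2
  have hv0 := ne_zero_of_mem_halfPlane hv.2
  obtain ⟨k, hk⟩ := exp_log_annMap hβ hu0
  obtain ⟨l, hl⟩ := exp_log_annMap hβ hv0
  rw [h, hl] at hk
  have hkl : l = k := by
    refine zpow_unique_of_mem_fundRing hβ one_pos hv.1 hu.1 ?_
    rw [← norm_zpow_mul, ← norm_zpow_mul, hk]
  rw [hkl] at hk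
  refine (mul_left_cancel₀ (zpow_ne_zero _ ?_) hk).symm
  exact_mod_cast (Real.exp_pos _).ne'

theorem image_annMap {β : ℝ} (hβ : 0 < β) :
    annMap β '' (fundRing β 1 ∩ halfPlane) = annulus β := by
  refine Subset.antisymm ?_ fun W hW => ?_
  · rintro _ ⟨u, hu, rfl⟩
    exact annMap_mem_annulus hβ hu.2
  · have hexp := Complex.exp_log (ne_zero_of_mem_annulus hW)
    rw [← hexp] at hW
    have h1 := (exp_mem_halfPlane hβ hW).1
    obtain ⟨k, hk⟩ := exists_zpow_mul_mem_fundRing hβ one_pos (ne_zero_of_mem_halfPlane h1)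
    refine ⟨_, ⟨hk, (zpow_mul_mem_halfPlane_iff k).2 h1⟩, ?_⟩
    rw [annMap_zpow_mul hβ k (ne_zero_of_mem_halfPlane h1), annMap_exp hβ hW, hexp]

/-- The derivative of `annMap` has modulus `‖annMap β u‖ / (β ‖u‖)`; the factor `1 / ‖u‖²` in its
square is absorbed by `mulMeasure`. -/
theorem lintegral_annulus {β : ℝ} (hβ : 0 < β) (q : ℂ → ENNReal) :
    ∫⁻ W in annulus β, q W = ∫⁻ u in fundRing β 1 ∩ halfPlane,
      ENNReal.ofReal ((‖annMap β u‖ / β) ^ 2) * q (annMap β u) ∂mulMeasure := by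
  have hs : MeasurableSet (fundRing β 1 ∩ halfPlane) :=
    (measurableSet_fundRing β 1).inter isOpen_halfPlane.measurableSet
  rw [← image_annMap hβ, lintegral_image_eq_lintegral_enorm_deriv_sq_mul hs
    (fun u hu => hasDerivAt_annMap β hu.2) (injOn_annMap hβ), mulMeasure,
    setLIntegral_withDensity_eq_setLIntegral_mul_non_measurable _ measurable_mulDensity _ hs
      (by simp)]
  refine lintegral_congr fun u => ?_
  rw [Pi.mul_apply, ← mul_assoc, ← ofReal_norm, ← ENNReal.ofReal_pow (norm_nonneg _),
    ← ENNReal.ofReal_mul (by positivity)]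
  congr 2
  simp only [norm_mul, norm_div, norm_neg, Complex.norm_I, norm_inv, Complex.norm_real,
    Real.norm_of_nonneg hβ.le, one_mul]
  ring

/-- The weight relating the two areas lies between positive constants, since the annulus is bounded
and stays away from `0`. -/
theorem lintegral_annulus_lt_top_iff {β : ℝ} (hβ : 0 < β) (q : ℂ → ENNReal) :
    ∫⁻ W in annulus β, q W < ⊤ ↔
      ∫⁻ u in fundRing β 1 ∩ halfPlane, q (annMap β u) ∂mulMeasure < ⊤ := by
  have hs : MeasurableSet (fundRing β 1 ∩ halfPlane) :=
    (measurableSet_fundRing β 1).inter isOpen_halfPlane.measurableSet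
  have hlow : 0 < Real.exp (-(Real.pi / (2 * β))) / β := by positivity
  rw [lintegral_annulus hβ]
  constructor <;> intro h
  · have h1 : ENNReal.ofReal ((Real.exp (-(Real.pi / (2 * β))) / β) ^ 2) *
        ∫⁻ u in fundRing β 1 ∩ halfPlane, q (annMap β u) ∂mulMeasure < ⊤ := by
      rw [← lintegral_const_mul' _ _ ENNReal.ofReal_ne_top]
      refine lt_of_le_of_lt (setLIntegral_mono' hs fun u hu => ?_) h
      gcongr
      exact (annMap_mem_annulus hβ hu.2).1.le
    refine (ENNReal.mul_lt_top_iff.1 h1).elim And.right fun h2 => h2.elim (fun h3 => ?_) fun h3 => ?_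
    · exact absurd h3 (ENNReal.ofReal_pos.2 (by positivity)).ne'
    · exact h3 ▸ ENNReal.zero_lt_top
  · refine lt_of_le_of_lt (setLIntegral_mono' hs fun u hu => ?_)
      (lt_of_eq_of_lt (lintegral_const_mul'
        (ENNReal.ofReal ((Real.exp (Real.pi / (2 * β)) / β) ^ 2))
        (fun u => q (annMap β u)) ENNReal.ofReal_ne_top) (ENNReal.mul_lt_top ENNReal.ofReal_lt_top h))
    gcongr
    exact (annMap_mem_annulus hβ hu.2).2.le

theorem memLp_annulus_iff {β : ℝ} {g : ℂ → ℂ} (hg : DifferentiableOn ℂ g (annulus β)) :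
    MemLp g 2 (volume.restrict (annulus β)) ↔ ∫⁻ W in annulus β, ‖g W‖ₑ ^ 2 < ⊤ :=
  memLp_two_iff_lintegral_enorm_sq
    (hg.continuousOn.aestronglyMeasurable (isOpen_annulus β).measurableSet)

/-- A holomorphic function on the half-plane that is invariant under `Γ_β` descends to the
annulus. -/
theorem differentiableOn_annulus_of_invariant {β : ℝ} (hβ : 0 < β) {g : ℂ → ℂ}
    (hg : DifferentiableOn ℂ g halfPlane)
    (hinv : ∀ (k : ℤ), ∀ u ∈ halfPlane, g ((Real.exp (2 * Real.pi * β) : ℂ) ^ k * u) = g u) :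
    DifferentiableOn ℂ (fun W => g (Complex.exp (Complex.I * β * Complex.log W))) (annulus β) := by
  intro W₀ hW₀
  have h0 := ne_zero_of_mem_annulus hW₀
  -- A logarithm that is holomorphic at `W₀` even when `W₀` lies on the cut of the principal branch;
  -- invariance of `g` makes the replacement harmless.
  let L : ℂ → ℂ := fun W => Complex.log W₀ + Complex.log (W / W₀)
  have hL : ∀ W ≠ 0, Complex.exp (L W) = W := by
    intro W hW
    rw [Complex.exp_add, Complex.exp_log h0, Complex.exp_log (div_ne_zero hW h0),
      mul_div_cancel₀ _ h0]
  have hLd : DifferentiableAt ℂ L W₀ := by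
    refine (differentiableAt_const _).add (DifferentiableAt.clog (by fun_prop) ?_)
    rw [div_self h0]
    exact Complex.one_mem_slitPlane
  have hmem : ∀ W ∈ annulus β, Complex.exp (Complex.I * β * L W) ∈ halfPlane := fun W hW =>
    (exp_mem_halfPlane hβ (by rwa [hL W (ne_zero_of_mem_annulus hW)])).1
  have hd : DifferentiableAt ℂ (fun W => g (Complex.exp (Complex.I * β * L W))) W₀ :=
    ((hg _ (hmem W₀ hW₀)).differentiableAt (isOpen_halfPlane.mem_nhds (hmem W₀ hW₀))).comp W₀
      (f := fun W => Complex.exp (Complex.I * β * L W)) (hLd.const_mul _).cexp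
  refine (hd.congr_of_eventuallyEq ?_).differentiableWithinAt
  filter_upwards [(isOpen_annulus β).mem_nhds hW₀] with W hW
  have hW0 := ne_zero_of_mem_annulus hW
  obtain ⟨k, hk⟩ := exp_eq_zpow_mul_exp β ((Complex.exp_log hW0).trans (hL W hW0).symm)
  rw [hk, hinv k _ (hmem W hW)]

/-- The Bergman space of a sector, in the product model. -/
theorem bergman_sector_iff {β : ℝ} (hβ : 0 < β) (f : Surface β → ℂ) {ε : ℂ} (hε : ε ≠ 0) :
    (HolomorphicOn f (sector β ε) ∧ SquareIntegrableOn f (sector β ε)) ↔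
      ∃ g : ℂ → ℂ, DifferentiableOn ℂ g (annulus β) ∧ MemLp g 2 (volume.restrict (annulus β)) ∧
        ∀ Z : ℂ, Z ≠ 0 → ∀ W ∈ annulus β, f (param β false
          (ε⁻¹ * Z, Z⁻¹ * Complex.exp (Complex.I * β * Complex.log W))) = g W := by
  constructor
  · rintro ⟨hf, hf2⟩
    obtain ⟨g, hg, hfac⟩ := exists_factorsThrough hβ hε hf hf2
    have hinv : ∀ (k : ℤ), ∀ u ∈ halfPlane, g ((Real.exp (2 * Real.pi * β) : ℂ) ^ k * u) = g u :=
      fun k u hu => hfac.zpow_mul hε k hu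
    have hd := differentiableOn_annulus_of_invariant hβ hg hinv
    refine ⟨_, hd, ?_, fun Z hZ W hW => ?_⟩
    · rw [memLp_annulus_iff hd, lintegral_annulus_lt_top_iff hβ]
      refine lt_of_eq_of_lt (setLIntegral_congr_fun
        ((measurableSet_fundRing β 1).inter isOpen_halfPlane.measurableSet) fun u hu => ?_)
        ((hfac.squareIntegrableOn_iff hβ hε hg).1 hf2)
      obtain ⟨k, hk⟩ := exp_log_annMap hβ (ne_zero_of_mem_halfPlane hu.2)
      simp only [hk, hinv k u hu.2]
    · have he : ε * (ε⁻¹ * Z) * (Z⁻¹ * Complex.exp (Complex.I * β * Complex.log W)) =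
          Complex.exp (Complex.I * β * Complex.log W) := by field_simp
      rw [hfac, he]
      rw [he]
      refine (exp_mem_halfPlane hβ ?_).1
      rwa [Complex.exp_log (ne_zero_of_mem_annulus hW)]
  · rintro ⟨g, hg, hg2, hfg⟩
    have hd : DifferentiableOn ℂ (fun u => g (annMap β u)) halfPlane :=
      hg.comp (fun u hu => (hasDerivAt_annMap β hu).differentiableAt.differentiableWithinAt)
        fun u hu => annMap_mem_annulus hβ hu
    have hfac : FactorsThrough f ε fun u => g (annMap β u) := by
      intro z w hzw
      have h0 := ne_zero_of_mem_halfPlane hzw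
      have hεz := left_ne_zero_of_mul h0
      -- The point `(z, [w])` has model coordinates `Z = ε z` and `W = annMap β (ε z w)`, up to an
      -- element of `Γ_β` acting on `w`.
      have h := hfg (ε * z) hεz _ (annMap_mem_annulus hβ hzw)
      obtain ⟨k, hk⟩ := exp_log_annMap hβ h0
      rw [inv_mul_cancel_left₀ hε, hk, mul_left_comm, inv_mul_cancel_left₀ hεz,
        param_zpow_mul] at h
      exact h
    refine ⟨hfac.holomorphicOn hd, (hfac.squareIntegrableOn_iff hβ hε hd).2 ?_⟩
    exact (lintegral_annulus_lt_top_iff hβ fun W => ‖g W‖ₑ ^ 2).1 ((memLp_annulus_iff hg).1 hg2)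

/-! ### Both domains are sectors. -/

theorem domainO_eq_sector (β : ℝ) : domainO β = sector β 1 := by
  simp [domainO, sector, halfPlane]

theorem isOpen_sector (β : ℝ) (ε : ℂ) : IsOpen (sector β ε) := by
  have hm : IsOpenMap fun x : ℂ × ℂˣ => (((x.1 : OnePoint ℂ), (x.2 : EllCurve β)) : Surface β) :=
    OnePoint.isOpenEmbedding_coe.isOpenMap.prodMap QuotientGroup.isOpenMap_coe
  have ho : IsOpen {x : ℂ × ℂˣ | ε * x.1 * (x.2 : ℂ) ∈ halfPlane} :=
    isOpen_halfPlane.preimage ((continuous_const.mul continuous_fst).mul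
      (Units.continuous_val.comp continuous_snd))
  convert! hm _ ho using 1
  ext p
  constructor
  · rintro ⟨z, w, hw, h, rfl⟩
    exact ⟨(z, Units.mk0 w hw), h, by simp [proj, hw]⟩
  · rintro ⟨⟨z, w⟩, h, rfl⟩
    exact ⟨z, w, w.ne_zero, h, by simp [proj]⟩

theorem exists_proj_eq {β : ℝ} (e : EllCurve β) : ∃ w : ℂ, w ≠ 0 ∧ proj β w = e := by
  obtain ⟨w, rfl⟩ := QuotientGroup.mk_surjective e
  exact ⟨w, w.ne_zero, by simp [proj]⟩

/-- Moving `z` by `t` times the conjugate of `w` raises `Re (z w)` by `t |w|²`. Small `t > 0` makes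
every point with `Re (z w) ≥ 0` a limit of points of `𝕆`, and `t → ∞` reaches `z = ∞`. Conversely,
the opposite sector is open and disjoint from `𝕆`. -/
theorem compl_closure_domainO (β : ℝ) : (closure (domainO β))ᶜ = sector β (-1) := by
  rw [domainO_eq_sector]
  refine Subset.antisymm (compl_subset_comm.1 ?_) (subset_compl_comm.1 ?_)
  · rintro ⟨z, e⟩ hp
    obtain ⟨w, hw, rfl⟩ := exists_proj_eq e
    have hw2 : 0 < Complex.normSq w := Complex.normSq_pos.2 hw
    have hre : ∀ (a : ℂ) (t : ℝ), ((1 : ℂ) * (a + t * (starRingEnd ℂ) w) * w).re =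
        (a * w).re + t * Complex.normSq w := by
      intro a t
      rw [one_mul, add_mul, mul_assoc, ← Complex.normSq_eq_conj_mul_self, Complex.add_re,
        Complex.re_ofReal_mul, Complex.ofReal_re]
    rcases eq_or_ne z OnePoint.infty with rfl | hz
    · have ht : Tendsto (fun t : ℝ => (((t : ℂ) * (starRingEnd ℂ) w : ℂ) : OnePoint ℂ)) atTop
          (𝓝 OnePoint.infty) := by
        refine OnePoint.tendsto_coe_infty.comp ?_
        rw [coclosedCompact_eq_cocompact, ← Metric.cobounded_eq_cocompact,
          ← tendsto_norm_atTop_iff_cobounded]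
        simp only [norm_mul, Complex.norm_real, RCLike.norm_conj]
        exact tendsto_norm_atTop_atTop.atTop_mul_const (norm_pos_iff.2 hw)
      refine mem_closure_of_tendsto (ht.prodMk_nhds (tendsto_const_nhds (x := proj β w))) ?_
      filter_upwards [eventually_gt_atTop 0] with t ht
      refine (mem_sector_iff hw).2 ?_
      have := hre 0 t
      rw [zero_add, zero_mul, Complex.zero_re, zero_add] at this
      rw [halfPlane, mem_ofPred_eq, this]
      positivity
    · obtain ⟨a, rfl⟩ := OnePoint.ne_infty_iff_exists.1 hz
      have hp' : 0 ≤ (a * w).re := by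
        have := fun h => hp ((mem_sector_iff hw).2 h)
        simpa [halfPlane] using this
      have ht : Tendsto (fun t : ℝ => ((a + (t : ℂ) * (starRingEnd ℂ) w : ℂ) : OnePoint ℂ)) (𝓝[>] 0)
          (𝓝 (a : OnePoint ℂ)) := by
        have hc : Continuous fun t : ℝ => ((a + (t : ℂ) * (starRingEnd ℂ) w : ℂ) : OnePoint ℂ) :=
          OnePoint.continuous_coe.comp (by fun_prop)
        simpa using (hc.tendsto 0).mono_left nhdsWithin_le_nhds
      refine mem_closure_of_tendsto (ht.prodMk_nhds (tendsto_const_nhds (x := proj β w))) ?_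
      filter_upwards [self_mem_nhdsWithin] with t ht
      refine (mem_sector_iff hw).2 ?_
      rw [halfPlane, mem_ofPred_eq, hre]
      have : 0 < t * Complex.normSq w := mul_pos ht hw2
      linarith
  · refine closure_minimal ?_ (isOpen_sector β (-1)).isClosed_compl
    rintro _ ⟨z, w, hw, h, rfl⟩ h'
    have h' := (mem_sector_iff hw).1 h'
    simp only [halfPlane, mem_ofPred_eq, one_mul, neg_mul, Complex.neg_re] at h h'
    linarith

/-! ### Weak differentials of classically differentiable functions. -/

section WeakDifferential

variable {V : Set (ℂ × ℂ)} {u G : ℂ × ℂ → ℂ} {v : ℂ × ℂ} {η : ℂ × ℂ → ℝ}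

theorem integrable_smul_of_tsupport_subset {φ : ℂ × ℂ → ℝ} (hu : LocallyIntegrableOn u V)
    (hφ : Continuous φ) (hc : HasCompactSupport φ) (hsub : tsupport φ ⊆ V) :
    Integrable fun x => φ x • u x := by
  rw [← integrableOn_iff_integrable_of_support_subset (s := tsupport φ)]
  · exact (hu.integrableOn_compact_subset hsub hc).continuousOn_smul hφ.continuousOn hc
  · exact (Function.support_smul_subset_left φ u).trans (subset_tsupport φ)

theorem integral_smul_eq_neg_integral_fderiv_smul (hV : IsOpen V)
    (hu : ∀ x ∈ V, DifferentiableAt ℝ u x) (hG : ContinuousOn G V)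
    (huG : ∀ x ∈ V, fderiv ℝ u x v = G x) (hη : ContDiff ℝ ∞ η) (hc : HasCompactSupport η)
    (hsub : tsupport η ⊆ V) :
    ∫ x, η x • G x = -∫ x, (fderiv ℝ η x v) • u x := by
  have huc : ContinuousOn u V := fun x hx => (hu x hx).continuousAt.continuousWithinAt
  have hul := huc.locallyIntegrableOn (μ := volume) hV.measurableSet
  have hGl := hG.locallyIntegrableOn (μ := volume) hV.measurableSet
  have heq : ∀ x, η x • fderiv ℝ u x v = η x • G x := by
    intro x
    by_cases hx : x ∈ tsupport η
    · rw [huG x (hsub hx)]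
    · rw [image_eq_zero_of_notMem_tsupport hx, zero_smul, zero_smul]
  have hsub' : tsupport (fun x => fderiv ℝ η x v) ⊆ tsupport η :=
    (tsupport_fderiv_apply_subset ℝ v)
  have : (volume : Measure (ℂ × ℂ)).IsAddHaarMeasure :=
    Measure.prod.instIsAddHaarMeasure volume volume
  simp only [← heq]
  refine integral_smul_fderiv_eq_neg_fderiv_smul_of_integrable ?_ ?_ ?_ ?_ ?_
  · exact integrable_smul_of_tsupport_subset hul
      ((hη.continuous_fderiv (by simp)).clm_apply continuous_const)
      (hc.fderiv_apply ℝ v) (hsub'.trans hsub)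
  · simp only [heq]
    exact integrable_smul_of_tsupport_subset hGl hη.continuous hc hsub
  · exact integrable_smul_of_tsupport_subset hul hη.continuous hc hsub
  · exact fun x _ => hη.differentiable (by simp) x
  · exact fun x hx => hu x (hsub hx)

/-- Integration by parts gives `D · v` and the classical derivative `G` the same integral against
every test function, so the fundamental lemma of the calculus of variations identifies them. -/
theorem HasWeakDifferentialOn.ae_apply_eq {D : ℂ × ℂ → (ℂ × ℂ →L[ℝ] ℂ)}
    (h : HasWeakDifferentialOn u D V) (hV : IsOpen V)
    (hu : ∀ x ∈ V, DifferentiableAt ℝ u x) (hG : ContinuousOn G V)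
    (huG : ∀ x ∈ V, fderiv ℝ u x v = G x) : ∀ᵐ x, x ∈ V → D x v = G x := by
  have hDl : LocallyIntegrableOn (fun x => D x v) V volume := fun x hx => by
    obtain ⟨s, hs, hD⟩ := h.2.1 x hx
    exact ⟨s, hs, hD.apply_continuousLinearMap v⟩
  have hGl := hG.locallyIntegrableOn (μ := volume) hV.measurableSet
  have h0 := hV.ae_eq_zero_of_integral_contDiff_smul_eq_zero (hDl.sub hGl) fun η hη hc hsub => by
    simp only [Pi.sub_apply, smul_sub]
    rw [integral_sub (integrable_smul_of_tsupport_subset hDl hη.continuous hc hsub)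
      (integrable_smul_of_tsupport_subset hGl hη.continuous hc hsub),
      integral_smul_eq_neg_integral_fderiv_smul hV hu hG huG hη hc hsub, h.2.2 η hη hc hsub v]
    simp
  exact h0.mono fun x hx hxV => sub_eq_zero.1 (hx hxV)

theorem hasWeakDifferentialOn_zero (hV : IsOpen V) {a : ℂ} (hu : ∀ x ∈ V, u x = a) :
    HasWeakDifferentialOn u (fun _ => 0) V := by
  have hloc : ∀ x ∈ V, u =ᶠ[𝓝 x] fun _ => a := fun x hx =>
    eventually_of_mem (hV.mem_nhds hx) hu
  have hd : ∀ x ∈ V, DifferentiableAt ℝ u x := fun x hx =>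
    (differentiableAt_const a).congr_of_eventuallyEq (hloc x hx)
  refine ⟨?_, continuousOn_const.locallyIntegrableOn hV.measurableSet, fun η hη hc hsub v => ?_⟩
  · exact ContinuousOn.locallyIntegrableOn
      (fun x hx => (hd x hx).continuousAt.continuousWithinAt) hV.measurableSet
  · have h := integral_smul_eq_neg_integral_fderiv_smul (G := fun _ => 0) (v := v) hV hd
      continuousOn_const (fun x hx => by
        rw [(hloc x hx).fderiv_eq]
        simp) hη hc hsub
    rw [← neg_eq_iff_eq_neg.2 h]
    simp

end WeakDifferential

/-! ### Holomorphic functions in `W¹` and the Dirichlet integral. -/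

theorem sobolevOneOn_of_const {β : ℝ} (hβ : 0 < β) {f : Surface β → ℂ} {ε : ℂ} (hε : ε ≠ 0)
    {a : ℂ} (hf : ∀ p ∈ sector β ε, f p = a) :
    HolomorphicOn f (sector β ε) ∧ SobolevOneOn f (sector β ε) := by
  have hfac : FactorsThrough f ε fun _ => a := fun z w h =>
    hf _ ((mem_sector_iff (right_ne_zero_of_mul (ne_zero_of_mem_halfPlane h))).2 h)
  have hd : DifferentiableOn ℂ (fun _ : ℂ => a) halfPlane := differentiableOn_const a
  refine ⟨hfac.holomorphicOn hd, (hfac.squareIntegrableOn_iff hβ hε hd).2 ?_, fun c =>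
    ⟨fun _ => 0, hasWeakDifferentialOn_zero (a := a) (isOpen_coordDom_sector β ε c)
      fun x hx => hf _ hx.2, ?_⟩⟩
  · refine (lintegral_annulus_lt_top_iff hβ fun _ => ‖a‖ₑ ^ 2).1 ?_
    rw [setLIntegral_const]
    refine ENNReal.mul_lt_top (by simp) (lt_of_le_of_lt (measure_mono fun W hW => ?_)
      (measure_ball_lt_top (x := (0 : ℂ)) (r := Real.exp (Real.pi / (2 * β)))))
    simpa using hW.2
  · simp [covectorNormSq]

/-- Only the first of the four frame vectors is kept; its factor `(1 + |z|²)²` is the reciprocal of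
the Fubini–Study density. -/
theorem le_covectorNormSq (x : ℂ × ℂ) (D : ℂ × ℂ →L[ℝ] ℂ) :
    (1 + ‖x.1‖ ^ 2) ^ 2 * ‖D (1, 0)‖ ^ 2 ≤ covectorNormSq x D := by
  have h : (((1 + ‖x.1‖ ^ 2 : ℝ) : ℂ), (0 : ℂ)) = (1 + ‖x.1‖ ^ 2 : ℝ) • ((1 : ℂ), (0 : ℂ)) := by
    simp
  have h2 : ‖D (((1 + ‖x.1‖ ^ 2 : ℝ) : ℂ), 0)‖ = (1 + ‖x.1‖ ^ 2) * ‖D (1, 0)‖ := by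
    rw [h, map_smul, norm_smul, Real.norm_of_nonneg (by positivity)]
  rw [covectorNormSq, h2, mul_pow, add_assoc]
  exact le_add_of_nonneg_right (by positivity)

theorem coordVol_absolutelyContinuous (β : ℝ) : coordVol β ≪ volume :=
  (withDensity_absolutelyContinuous _ _).trans Measure.restrict_le_self.absolutelyContinuous

theorem mulMeasure_fundRing_ne_zero {β : ℝ} (hβ : 0 < β) : mulMeasure (fundRing β 1) ≠ 0 := by
  intro h
  have h1 := volume_absolutelyContinuous_mulMeasure h
  have hU : IsOpen {u : ℂ | 1 < ‖u‖ ∧ ‖u‖ < Real.exp (2 * Real.pi * β)} :=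
    (isOpen_lt continuous_const continuous_norm).inter (isOpen_lt continuous_norm continuous_const)
  refine (hU.measure_pos volume ⟨_, (exp_pi_mul_mem_interior hβ).1⟩).ne' (measure_mono_null ?_ h1)
  exact fun u hu => ⟨hu.1.le, by simpa using hu.2⟩

/-- A function of `ε z w` with a square integrable weak differential has finite Dirichlet integral
on the half-plane. -/
theorem FactorsThrough.lintegral_deriv_lt_top {β : ℝ} (hβ : 0 < β) {f : Surface β → ℂ} {ε : ℂ}
    (hε : ε ≠ 0) {g : ℂ → ℂ} (h : FactorsThrough f ε g) (hg : DifferentiableOn ℂ g halfPlane)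
    (hf : SobolevOneOn f (sector β ε)) :
    ∫⁻ u in halfPlane, ‖deriv g u‖ₑ ^ 2 < ⊤ := by
  classical
  obtain ⟨D, hD, hint⟩ := hf.2 false
  set V := coordDom β false (sector β ε) with hVdef
  have hV : IsOpen V := isOpen_coordDom_false_sector β ε
  have hVmem : ∀ x, x ∈ V ↔ ε * x.1 * x.2 ∈ halfPlane := fun x => by
    rw [hVdef, coordDom_false_sector]
    rfl
  have hdg : ContinuousOn (deriv g) halfPlane := (hg.deriv isOpen_halfPlane).continuousOn
  have hfd : ∀ x ∈ V, HasFDerivAt (fun x => f (param β false x))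
      ((deriv g (ε * x.1 * x.2) • ((ε * x.1) • ContinuousLinearMap.snd ℂ ℂ ℂ +
        x.2 • (ε • ContinuousLinearMap.fst ℂ ℂ ℂ))).restrictScalars ℝ) x := by
    intro x hx
    have h1 : HasDerivAt g (deriv g (ε * x.1 * x.2)) (ε * x.1 * x.2) :=
      ((hg _ ((hVmem x).1 hx)).differentiableAt
        (isOpen_halfPlane.mem_nhds ((hVmem x).1 hx))).hasDerivAt
    have h2 : HasFDerivAt (fun x : ℂ × ℂ => ε * x.1 * x.2)
        ((ε * x.1) • ContinuousLinearMap.snd ℂ ℂ ℂ +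
          x.2 • (ε • ContinuousLinearMap.fst ℂ ℂ ℂ)) x :=
      (hasFDerivAt_fst.const_mul ε).mul hasFDerivAt_snd
    refine HasFDerivAt.restrictScalars ℝ ((h1.comp_hasFDerivAt x h2).congr_of_eventuallyEq ?_)
    exact eventually_of_mem (hV.mem_nhds hx) fun y hy => h y.1 y.2 ((hVmem y).1 hy)
  have hG : ContinuousOn (fun x : ℂ × ℂ => deriv g (ε * x.1 * x.2) * (ε * x.2)) V :=
    (hdg.comp (f := fun x : ℂ × ℂ => ε * x.1 * x.2) (by fun_prop) fun x hx =>
      (hVmem x).1 hx).mul (by fun_prop)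
  have hae := hD.ae_apply_eq (v := (1, 0)) hV (fun x hx => (hfd x hx).differentiableAt) hG
    fun x hx => by
      rw [(hfd x hx).fderiv]
      simp [mul_comm]
  let Q : ℂ × ℂ → ENNReal := V.indicator fun x =>
    ENNReal.ofReal ((1 + ‖x.1‖ ^ 2) ^ 2) * ‖deriv g (ε * x.1 * x.2) * (ε * x.2)‖ₑ ^ 2
  have hQm : Measurable Q := by
    have h1 : Measurable (V.indicator fun x : ℂ × ℂ =>
        ‖deriv g (ε * x.1 * x.2) * (ε * x.2)‖ₑ ^ 2) := by
      rw [← piecewise_eq_indicator]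
      exact ((ENNReal.continuous_pow 2).comp_continuousOn hG.enorm).measurable_piecewise
        continuousOn_const hV.measurableSet
    have h2 : Q = fun x => ENNReal.ofReal ((1 + ‖x.1‖ ^ 2) ^ 2) * (V.indicator fun x : ℂ × ℂ =>
        ‖deriv g (ε * x.1 * x.2) * (ε * x.2)‖ₑ ^ 2) x := by
      funext x
      exact indicator_mul_right V _ _
    rw [h2]
    exact (by fun_prop : Measurable fun x : ℂ × ℂ =>
      ENNReal.ofReal ((1 + ‖x.1‖ ^ 2) ^ 2)).mul h1
  have hQint : ∫⁻ x, Q x ∂coordVol β < ⊤ := by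
    rw [lintegral_indicator hV.measurableSet]
    refine lt_of_le_of_lt (lintegral_mono_ae ?_) hint
    refine (ae_restrict_iff' hV.measurableSet).2 ?_
    filter_upwards [(coordVol_absolutelyContinuous β).ae_le hae] with x hx hxV
    rw [← hx hxV, ← ofReal_norm, ← ENNReal.ofReal_pow (norm_nonneg _),
      ← ENNReal.ofReal_mul (by positivity)]
    exact ENNReal.ofReal_le_ofReal (le_covectorNormSq x (D x))
  rw [coordVol_eq_prod, lintegral_prod_symm _ hQm.aemeasurable] at hQint
  have hw := ae_lt_top (hQm.lintegral_prod_left') hQint.ne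
  have : (ae (mulMeasure.restrict (fundRing β 1))).NeBot := by
    rw [ae_neBot, Ne, Measure.restrict_eq_zero]
    exact mulMeasure_fundRing_ne_zero hβ
  -- A single good `w` is enough: as `z` runs over `ℂ`, `u = ε w z` covers the whole half-plane, and
  -- the Jacobian `|ε w|²` is the factor produced by the chain rule.
  obtain ⟨w, hw1, hw2⟩ := (hw.and (ae_restrict_mem (measurableSet_fundRing β 1))).exists
  have hw0 : w ≠ 0 := norm_pos_iff.1 (one_pos.trans_le hw2.1)
  refine lt_of_eq_of_lt ?_ hw1
  rw [← lintegral_indicator isOpen_halfPlane.measurableSet,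
    lintegral_comp_mul_left _ (mul_ne_zero hε hw0),
    ← lintegral_const_mul' _ _ (ENNReal.pow_ne_top enorm_ne_top), fsMeasure,
    lintegral_withDensity_eq_lintegral_mul_non_measurable _ measurable_fsDensity
      (by simp [fsDensity])]
  refine lintegral_congr fun z => ?_
  have he : ε * w * z = ε * z * w := by ring
  have hone : fsDensity z * ENNReal.ofReal ((1 + ‖z‖ ^ 2) ^ 2) = 1 := by
    rw [fsDensity, ← ENNReal.ofReal_mul (by positivity), one_div, inv_mul_cancel₀ (by positivity),
      ENNReal.ofReal_one]
  rw [he, Pi.mul_apply]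
  by_cases hz : ε * z * w ∈ halfPlane
  · simp only [Q]
    rw [indicator_of_mem hz, indicator_of_mem ((hVmem (z, w)).2 hz), ← mul_assoc, hone, one_mul,
      ← mul_pow, ← enorm_mul, mul_comm (ε * w)]
  · simp only [Q]
    rw [indicator_of_notMem hz, indicator_of_notMem fun h' => hz ((hVmem (z, w)).1 h'), mul_zero,
      mul_zero]

/-- A holomorphic function on the half-plane that is invariant under multiplication by
`e^{2πβ}` and has finite Dirichlet integral is constant. -/
theorem exists_const_of_lintegral_deriv_lt_top {β : ℝ} (hβ : 0 < β) {g : ℂ → ℂ}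
    (hg : DifferentiableOn ℂ g halfPlane)
    (hinv : ∀ u ∈ halfPlane, g ((Real.exp (2 * Real.pi * β) : ℂ) * u) = g u)
    (hint : ∫⁻ u in halfPlane, ‖deriv g u‖ₑ ^ 2 < ⊤) : ∃ a, ∀ u ∈ halfPlane, g u = a := by
  classical
  set R := Real.exp (2 * Real.pi * β) with hRdef
  have hR : 0 < R := Real.exp_pos _
  have hR1 : 1 < R := one_lt_exp_two_pi_mul hβ
  have hRc : (R : ℂ) ≠ 0 := by exact_mod_cast hR.ne'
  have hmem : ∀ u, (R : ℂ) * u ∈ halfPlane ↔ u ∈ halfPlane := fun u => by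
    have h := zpow_mul_mem_halfPlane_iff (β := β) 1 (u := u)
    rwa [zpow_one] at h
  have hderiv : ∀ u ∈ halfPlane, R * deriv g ((R : ℂ) * u) = deriv g u := by
    intro u hu
    have h1 : (fun u => g ((R : ℂ) * u)) =ᶠ[𝓝 u] g :=
      eventually_of_mem (isOpen_halfPlane.mem_nhds hu) hinv
    rw [← h1.deriv_eq, deriv_comp_mul_left]
    rfl
  let q : ℂ → ENNReal := halfPlane.indicator fun u => ‖deriv g u‖ₑ ^ 2
  have hqm : Measurable q := by
    simp only [q]
    rw [← piecewise_eq_indicator]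
    exact ((ENNReal.continuous_pow 2).comp_continuousOn
      (hg.deriv isOpen_halfPlane).continuousOn.enorm).measurable_piecewise
        continuousOn_const isOpen_halfPlane.measurableSet
  have hq : ∀ u, ‖(R : ℂ)‖ₑ ^ 2 * q (R * u) = q u := by
    intro u
    by_cases hu : u ∈ halfPlane
    · simp only [q]
      rw [indicator_of_mem hu, indicator_of_mem ((hmem u).2 hu), ← mul_pow, ← enorm_mul,
        hderiv u hu]
    · simp only [q]
      rw [indicator_of_notMem hu, indicator_of_notMem fun h => hu ((hmem u).1 h), mul_zero]
  have hms : ∀ c : ℝ, MeasurableSet {u : ℂ | c ≤ ‖u‖} := fun c =>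
    measurableSet_le measurable_const measurable_norm
  -- Scale invariance of the Dirichlet integral replaces a sum over infinitely many rings: the two
  -- integrals are equal and finite, so the ring `1 ≤ ‖u‖ < R` between them contributes nothing.
  have hscale : ∫⁻ u in {u | R ≤ ‖u‖}, q u = ∫⁻ u in {u | 1 ≤ ‖u‖}, q u := by
    rw [← lintegral_indicator (hms R), ← lintegral_indicator (hms 1),
      lintegral_comp_mul_left _ hRc, ← lintegral_const_mul' _ _ (by simp)]
    refine lintegral_congr fun u => ?_
    have hiff : (R : ℂ) * u ∈ {u : ℂ | R ≤ ‖u‖} ↔ u ∈ {u : ℂ | 1 ≤ ‖u‖} := by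
      rw [mem_ofPred_eq, mem_ofPred_eq, norm_mul, Complex.norm_real, Real.norm_of_nonneg hR.le,
        le_mul_iff_one_le_right hR]
    by_cases hu : u ∈ {u : ℂ | 1 ≤ ‖u‖}
    · rw [indicator_of_mem hu, indicator_of_mem (hiff.2 hu), hq]
    · rw [indicator_of_notMem hu, indicator_of_notMem fun h => hu (hiff.1 h), mul_zero]
  have hfin : ∫⁻ u in {u | R ≤ ‖u‖}, q u ≠ ⊤ := by
    refine (lt_of_le_of_lt (setLIntegral_le_lintegral _ _) ?_).ne
    rwa [lintegral_indicator isOpen_halfPlane.measurableSet]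
  have hring : ∫⁻ u in fundRing β 1, q u = 0 := by
    have hsplit : {u : ℂ | 1 ≤ ‖u‖} = fundRing β 1 ∪ {u | R ≤ ‖u‖} := by
      ext u
      simp only [fundRing, mem_union, mem_ofPred_eq, one_mul, ← hRdef]
      constructor
      · intro h
        rcases lt_or_ge ‖u‖ R with h' | h'
        exacts [Or.inl ⟨h, h'⟩, Or.inr h']
      · rintro (h | h)
        exacts [h.1, hR1.le.trans h]
    have hdisj : Disjoint (fundRing β 1) {u : ℂ | R ≤ ‖u‖} := by
      refine Set.disjoint_left.2 fun u hu hu' => ?_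
      have h1 : ‖u‖ < 1 * R := hu.2
      rw [one_mul] at h1
      exact absurd h1 (not_lt.2 hu')
    rw [hsplit, lintegral_union (hms R) hdisj] at hscale
    exact (ENNReal.add_left_inj hfin).1 (hscale.symm.trans (zero_add _).symm)
  have hzero : EqOn (deriv g) (fun _ => 0) halfPlane := by
    refine eqOn_halfPlane_of_ae_eq hβ (hg.deriv isOpen_halfPlane) (differentiableOn_const 0) ?_
    have h1 := (ae_restrict_iff' (measurableSet_fundRing β 1)).1
      ((lintegral_eq_zero_iff hqm).1 hring)
    filter_upwards [h1] with u hu h2 h3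
    have h4 := hu h2
    simp only [q] at h4
    rw [indicator_of_mem h3] at h4
    simpa using h4
  exact isOpen_halfPlane.exists_is_const_of_deriv_eq_zero isPreconnected_halfPlane hg
    fun u hu => hzero hu

theorem sobolev_sector_iff {β : ℝ} (hβ : 0 < β) (f : Surface β → ℂ) {ε : ℂ} (hε : ε ≠ 0) :
    (HolomorphicOn f (sector β ε) ∧ SobolevOneOn f (sector β ε)) ↔
      ∃ a : ℂ, ∀ p ∈ sector β ε, f p = a := by
  refine ⟨?_, fun ⟨a, ha⟩ => sobolevOneOn_of_const hβ hε ha⟩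
  rintro ⟨hf, hf1⟩
  obtain ⟨g, hg, hfac⟩ := exists_factorsThrough hβ hε hf hf1.1
  obtain ⟨a, ha⟩ := exists_const_of_lintegral_deriv_lt_top hβ hg
    (fun u hu => by simpa using hfac.zpow_mul hε 1 hu)
    (hfac.lintegral_deriv_lt_top hβ hε hg hf1)
  refine ⟨a, ?_⟩
  rintro _ ⟨z, w, hw, h, rfl⟩
  exact (hfac z w h).trans (ha _ h)

end Ohsawa

end

theorem lemma4p2 (β : ℝ) (hβ : 0 < β) :
    -- (1) the Bergman space of `𝕆`
    (∀ f : Ohsawa.Surface β → ℂ,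
      (Ohsawa.HolomorphicOn f (Ohsawa.domainO β) ∧
        Ohsawa.SquareIntegrableOn f (Ohsawa.domainO β)) ↔
      ∃ g : ℂ → ℂ, DifferentiableOn ℂ g (Ohsawa.annulus β) ∧
        MemLp g 2 (volume.restrict (Ohsawa.annulus β)) ∧
        ∀ Z : ℂ, Z ≠ 0 → ∀ W ∈ Ohsawa.annulus β, f (Ohsawa.modelO β Z W) = g W) ∧
    -- (2) the holomorphic Sobolev space of `𝕆`
    (∀ f : Ohsawa.Surface β → ℂ,
      (Ohsawa.HolomorphicOn f (Ohsawa.domainO β) ∧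
        Ohsawa.SobolevOneOn f (Ohsawa.domainO β)) ↔
      ∃ a : ℂ, ∀ p ∈ Ohsawa.domainO β, f p = a) ∧
    -- (3) the same for the complement of the closure of `𝕆`
    (∀ f : Ohsawa.Surface β → ℂ,
      (Ohsawa.HolomorphicOn f (closure (Ohsawa.domainO β))ᶜ ∧
        Ohsawa.SquareIntegrableOn f (closure (Ohsawa.domainO β))ᶜ) ↔
      ∃ g : ℂ → ℂ, DifferentiableOn ℂ g (Ohsawa.annulus β) ∧
        MemLp g 2 (volume.restrict (Ohsawa.annulus β)) ∧
        ∀ Z : ℂ, Z ≠ 0 → ∀ W ∈ Ohsawa.annulus β, f (Ohsawa.modelExt β Z W) = g W) ∧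
    (∀ f : Ohsawa.Surface β → ℂ,
      (Ohsawa.HolomorphicOn f (closure (Ohsawa.domainO β))ᶜ ∧
        Ohsawa.SobolevOneOn f (closure (Ohsawa.domainO β))ᶜ) ↔
      ∃ a : ℂ, ∀ p ∈ (closure (Ohsawa.domainO β))ᶜ, f p = a) := by
  have hO := Ohsawa.domainO_eq_sector β
  have hE := Ohsawa.compl_closure_domainO β
  refine ⟨fun f => ?_, fun f => ?_, fun f => ?_, fun f => ?_⟩
  · rw [hO, Ohsawa.bergman_sector_iff hβ f one_ne_zero]
    simp only [inv_one, one_mul]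
    rfl
  · rw [hO]
    exact Ohsawa.sobolev_sector_iff hβ f one_ne_zero
  · rw [hE, Ohsawa.bergman_sector_iff hβ f (neg_ne_zero.2 one_ne_zero)]
    simp only [inv_neg_one, neg_one_mul]
    rfl
  · rw [hE]
    exact Ohsawa.sobolev_sector_iff hβ f (neg_ne_zero.2 one_ne_zero)
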